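/- Let $(X_k)_{k\in\mathbb Z}$ be a centered stationary Gaussian sequence with unit variance and covariance $E[X_kX_l]=\rho(k-l)$, and let $q\ge 2$ be an even integer. Let $H_q$ be the $q$th Hermite polynomial, $H_q(x)=(-1)^q e^{x^2/2}\frac{d^q}{dx^q}e^{-x^2/2}$. For $n\ge 1$ set $$V_n=\frac1{\sqrt n}\sum_{k=0}^{n-1}H_q(X_k),\qquad v_n=E[V_n^2]>0,\qquad F_n=\frac{V_n}{\sqrt{v_n}},$$ and let $d_3(q)=2\,q\,q!\,(q/2-1)!\binom{q-1}{q/2-1}^2$. Let $\kappa_3(F)=(-i)^3\frac{d^3}{dt^3}\log E[e^{itF}]\big|_{t=0}$ denote the third cumulant of a random variable $F$ with $E|F|^3<\infty$; each $F_n$ is such a random variable. Then, for every $n\ge1$, $$\kappa_3(F_n)\le\frac{d_3(q)}{v_n^{3/2}\sqrt n}\Big(\sum_{|k|<n}|\rho(k)|^{3q/4}\Big)^2 .$$ If moreover $\rho\in\ell^{3q/4}(\mathbb Z)$, i.e. $\sum_{k\in\mathbb Z}|\rho(k)|^{3q/4}<\infty$, then the Fourier series $g_{q/2}(t)=\sum_{k\in\mathbb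 Z}\rho(k)^{q/2}e^{ikt}$ converges in $L^2$ of the torus $\mathbb T=\mathbb R/2\pi\mathbb Z$; its sum is real and nonnegative almost everywhere; $g_{q/2}^2$ and $g_{q/2}^3$ are integrable with strictly positive integrals (with respect to Lebesgue measure $dt$, of total mass $2\pi$); and, as $n\to\infty$, $$\sqrt n\,\kappa_3(F_n)\longrightarrow\frac{d_3(q)}{(q!)^{3/2}}\,\sqrt{2\pi}\;\frac{\int_{\mathbb T}g_{q/2}(t)^3\,dt}{\big(\int_{\mathbb T}g_{q/2}(t)^2\,dt\big)^{3/2}}\;>\;0 .$$ -/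

import Mathlib

open MeasureTheory ProbabilityTheory Filter Topology
open scoped Real ENNReal Nat

noncomputable section

namespace BreuerMajor

/-- The `j`-th cumulant `κ_j(F) = (-i)^j (d^j/dt^j) log φ_F(t) |_{t = 0}` of a real random variable
`F` with finite `j`-th absolute moment, `φ_F` being its characteristic function
(the number on the right is real, and is read as a real number through `Complex.re`). -/
def cumulant {Ω : Type*} [MeasurableSpace Ω] (P : Measure Ω) (j : ℕ) (F : Ω → ℝ) : ℝ :=
  ((-Complex.I) ^ j *
    iteratedDeriv j (fun t : ℝ => Complex.log (charFun (P.map F) t)) 0).re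

/-- The `q`-th (probabilists') Hermite polynomial function. -/
def H (q : ℕ) (x : ℝ) : ℝ := Polynomial.aeval x (Polynomial.hermite q)

/-- `V_n = n^{-1/2} ∑_{k=0}^{n-1} H_q(X_k)`. -/
def V {Ω : Type*} (X : ℤ → Ω → ℝ) (q n : ℕ) (ω : Ω) : ℝ :=
  1 / √(n : ℝ) * ∑ k ∈ Finset.range n, H q (X (k : ℤ) ω)

/-- `v_n = E[V_n^2]`. -/
def v {Ω : Type*} [MeasurableSpace Ω] (P : Measure Ω) (X : ℤ → Ω → ℝ) (q n : ℕ) : ℝ :=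
  ∫ ω, V X q n ω ^ 2 ∂P

/-- `F_n = V_n / √v_n`. -/
def F {Ω : Type*} [MeasurableSpace Ω] (P : Measure Ω) (X : ℤ → Ω → ℝ) (q n : ℕ) (ω : Ω) : ℝ :=
  V X q n ω / √(v P X q n)

/-- `d_3(q) = 2 q q! (q/2 - 1)! C(q - 1, q/2 - 1)^2`, for even `q ≥ 2`. -/
def d₃ (q : ℕ) : ℕ :=
  2 * q * q ! * (q / 2 - 1)! * (q - 1).choose (q / 2 - 1) ^ 2

/-- `X` is a centered stationary Gaussian sequence with unit variance and covariance function `ρ`: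
all finite-dimensional laws are Gaussian, `E[X_k] = 0`, `E[X_k X_l] = ρ(k - l)`, `ρ(0) = 1`. -/
structure IsStationaryGaussian {Ω : Type*} [MeasurableSpace Ω] (P : Measure Ω)
    (X : ℤ → Ω → ℝ) (ρ : ℤ → ℝ) : Prop where
  gaussian : IsGaussianProcess X P
  centered : ∀ k, ∫ ω, X k ω ∂P = 0
  cov : ∀ k l, ∫ ω, X k ω * X l ω ∂P = ρ (k - l)
  unit_variance : ρ 0 = 1

instance fact_two_pi_pos : Fact (0 < 2 * π) := ⟨Real.two_pi_pos⟩

/-- The torus `ℝ / 2πℤ`; its `volume` is Lebesgue measure, of total mass `2π`. -/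
abbrev Torus : Type := AddCircle (2 * π)

/-- The `k`-th term `t ↦ a(k) e^{ikt}` of the Fourier series with coefficients `a`,
as an element of `L²` of the torus. -/
def fourierTerm (a : ℤ → ℝ) (k : ℤ) :
    Lp ℂ 2 (AddCircle.haarAddCircle : Measure Torus) :=
  (a k : ℂ) • fourierLp 2 k

/-- The sum in `L²` of the Fourier series `∑_k a(k) e^{ikt}` (meaningful when it converges). -/
def fourierSum (a : ℤ → ℝ) : Lp ℂ 2 (AddCircle.haarAddCircle : Measure Torus) :=
  ∑' k : ℤ, fourierTerm a k

/-- `g_m(t) = ∑_k ρ(k)^m e^{ikt}`, as a real function on the torus, defined almost everywhere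
(that the sum is real almost everywhere is part of the theorem using it). -/
def g (ρ : ℤ → ℝ) (m : ℕ) (t : Torus) : ℝ :=
  (fourierSum (fun k => ρ k ^ m) t).re

end BreuerMajor

end

noncomputable section

namespace BreuerMajor

/-! Write q = 2m and f = ρ^m. The third cumulant of a centered variable is its third moment, and
Gaussian integration by parts with H_{a+1} = x H_a - H_a' contracts a product of three Hermite
variables down to d_3(q) f(j-i) f(k-i) f(k-j). Hence `cumulant_F`: κ_3(F_n) is exactly d_3(q) /
(v_n^{3/2} √n) times the average (1/n) ∑ f(a-b) f(c-b) f(c-a) over indices in [0, n).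

For the bound, AM-GM splits f f f into products of |f|^{3/2} over pairs of edges of a triangle. The
two edges share a vertex, so fixing it leaves two one-dimensional sums (`sum_mul_mul_le`).

For the limit, the same splitting gives absolute summability, so dominated convergence sends the
average to `tripleSum f` and v_n to q! ∑ f². It remains to show that `tripleSum f` is the mean of
g³, although g is only known to be in L². As m! f(a-b) is the covariance of the variables H_m(X_k),
f is positive definite and its Fejér means σ_n are nonnegative. Both ∫ σ_n³ and ∫ g σ_n² tend to
`tripleSum f`. Fatou along a subsequence gives ∫ g³ ≤ `tripleSum f`; the inequality 3 g σ_n² ≤ g³ +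
2 σ_n³ gives the converse (`integrable_cube_and_integral_cube`). The limit is positive because g ≥ 0
and ∫ g³ = 0 would force g = 0, against Parseval and f(0) = 1. -/

/-! ### Hermite polynomials over ℝ -/

open Polynomial in
/-- The Hermite polynomial with real coefficients. -/
def realHermite (n : ℕ) : ℝ[X] := (hermite n).map (Int.castRingHom ℝ)

lemma H_eq_eval (n : ℕ) (x : ℝ) : H n x = (realHermite n).eval x := by
  simp [H, realHermite, Polynomial.aeval_def, Polynomial.eval_map]

lemma realHermite_zero : realHermite 0 = 1 := by simp [realHermite]

open Polynomial in
lemma realHermite_succ (n : ℕ) :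
    realHermite (n + 1) = X * realHermite n - derivative (realHermite n) := by
  simp [realHermite, hermite_succ, derivative_map]

-- The Appell property: differentiating lowers the degree by one, so each integration by parts below
-- stays within Hermite polynomials.
open Polynomial in
lemma derivative_realHermite_succ (n : ℕ) :
    derivative (realHermite (n + 1)) = C ((n : ℝ) + 1) * realHermite n := by
  induction n with
  | zero => simp [realHermite_succ, realHermite_zero]
  | succ n ih =>
    rw [realHermite_succ, derivative_sub, derivative_mul, derivative_X, ih, derivative_mul,
      derivative_C]
    have := realHermite_succ n
    simp only [map_add, C_1, Nat.cast_add, Nat.cast_one] at *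
    linear_combination ((C (n : ℝ)) + 1) * (-1) * this

open Polynomial in
lemma derivative_realHermite (n : ℕ) :
    derivative (realHermite n) = C (n : ℝ) * realHermite (n - 1) := by
  cases n with
  | zero => simp [realHermite_zero]
  | succ n => simpa using derivative_realHermite_succ n

/-! ### Gaussian integration by parts for polynomials -/

lemma integrable_polynomial_gaussianReal (p : Polynomial ℝ) :
    Integrable (fun x => p.eval x) (gaussianReal 0 1) := by
  simp only [Polynomial.eval_eq_sum_range]
  refine integrable_finsetSum _ fun i _ => Integrable.const_mul ?_ _
  rcases Nat.eq_zero_or_pos i with rfl | hi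
  · simp
  have h := (memLp_id_gaussianReal' (μ := 0) (v := 1) (i : ℝ≥0∞) (by simp)).integrable_norm_pow
    hi.ne'
  refine (integrable_norm_iff (by fun_prop)).1 (h.congr (ae_of_all _ fun x => ?_))
  simp

lemma hasDerivAt_gaussianPDFReal (x : ℝ) :
    HasDerivAt (gaussianPDFReal 0 1) (-x * gaussianPDFReal 0 1 x) x := by
  have h1 : HasDerivAt (fun y : ℝ => -(y - 0) ^ 2 / (2 * (1 : NNReal))) (-x) x :=
    ((((hasDerivAt_id x).sub_const 0).pow 2).neg.div_const (2 * (1 : NNReal) : ℝ)).congr_deriv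
      (by simp; ring)
  refine ((h1.exp).const_mul (√(2 * π * (1 : NNReal)))⁻¹).congr_deriv ?_
  simp only [gaussianPDFReal]
  ring

/-- The Gaussian density φ satisfies φ' = -xφ, and the derivative of φ p has zero integral over the
line. -/
lemma integral_mul_polynomial_gaussianReal (p : Polynomial ℝ) :
    ∫ x, x * p.eval x ∂(gaussianReal 0 1) = ∫ x, (Polynomial.derivative p).eval x ∂(gaussianReal 0 1) := by
  have hint : ∀ r : Polynomial ℝ, Integrable (fun x => gaussianPDFReal 0 1 x * r.eval x) := by
    intro r
    have := integrable_polynomial_gaussianReal r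
    rw [gaussianReal_of_var_ne_zero _ one_ne_zero] at this
    rw [integrable_withDensity_iff_integrable_smul' (by fun_prop)
      (ae_of_all _ fun _ => gaussianPDF_lt_top)] at this
    simpa using this
  have hz : ∫ x, (-x * gaussianPDFReal 0 1 x * p.eval x
      + gaussianPDFReal 0 1 x * (Polynomial.derivative p).eval x) = 0 := by
    refine integral_eq_zero_of_hasDerivAt_of_integrable
      (f := fun x => gaussianPDFReal 0 1 x * p.eval x) (fun x => ?_) ?_ (hint p)
    · exact (hasDerivAt_gaussianPDFReal x).mul (p.hasDerivAt x)
    · refine (((hint (Polynomial.X * p)).neg).add (hint (Polynomial.derivative p))).congr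
        (ae_of_all _ fun x => ?_)
      simp; ring
  rw [integral_gaussianReal_eq_integral_smul one_ne_zero,
    integral_gaussianReal_eq_integral_smul one_ne_zero]
  have h1 := hint (Polynomial.X * p)
  have h2 := hint (Polynomial.derivative p)
  have : ∫ x, (gaussianPDFReal 0 1 x * (Polynomial.derivative p).eval x
      - gaussianPDFReal 0 1 x * (Polynomial.X * p).eval x) = 0 := by
    refine Eq.trans (integral_congr_ae (ae_of_all _ fun x => ?_)) hz
    simp; ring
  rw [integral_sub h2 h1] at this
  simp only [smul_eq_mul]
  simp only [Polynomial.eval_mul, Polynomial.eval_X] at this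
  linarith

/-! ### Random variables with all moments -/

/-- All moments of `f` are finite. -/
def AllMoments {Ω : Type*} [MeasurableSpace Ω] (P : Measure Ω) (f : Ω → ℝ) : Prop :=
  ∀ p : ℝ≥0∞, p ≠ ∞ → MemLp f p P

namespace AllMoments

variable {Ω : Type*} [MeasurableSpace Ω] {P : Measure Ω} {f h : Ω → ℝ}

lemma mul (hf : AllMoments P f) (hh : AllMoments P h) : AllMoments P (fun ω => f ω * h ω) := by
  intro p hp
  have h2 : (2 * p) ≠ ∞ := ENNReal.mul_ne_top (by simp) hp
  have : ENNReal.HolderTriple (2 * p) (2 * p) p := ⟨by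
    rw [ENNReal.mul_inv (by simp) (by simp), ← add_mul, ENNReal.inv_two_add_inv_two, one_mul]⟩
  exact (hh _ h2).mul (hf _ h2)

lemma const [IsFiniteMeasure P] (c : ℝ) : AllMoments P (fun _ => c) := fun _ _ => memLp_const c

lemma const_mul (hf : AllMoments P f) (c : ℝ) : AllMoments P (fun ω => c * f ω) :=
  fun p hp => (hf p hp).const_mul c

lemma sum {ι : Type*} (s : Finset ι) {f : ι → Ω → ℝ} (hf : ∀ i ∈ s, AllMoments P (f i)) :
    AllMoments P (fun ω => ∑ i ∈ s, f i ω) :=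
  fun p hp => memLp_finsetSum s fun i hi => hf i hi p hp

lemma pow [IsFiniteMeasure P] (hf : AllMoments P f) (n : ℕ) :
    AllMoments P (fun ω => f ω ^ n) := by
  induction n with
  | zero => simpa using const 1
  | succ n ih => simpa only [pow_succ] using ih.mul hf

lemma polynomial [IsFiniteMeasure P] (hf : AllMoments P f) (p : Polynomial ℝ) :
    AllMoments P (fun ω => p.eval (f ω)) := by
  simp only [Polynomial.eval_eq_sum_range]
  exact sum _ fun i _ => (hf.pow i).const_mul _

lemma integrable (hf : AllMoments P f) : Integrable f P :=
  memLp_one_iff_integrable.1 (hf 1 (by simp))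

end AllMoments

/-! ### Mixed Hermite moments of the process -/

namespace IsStationaryGaussian

variable {Ω : Type*} [MeasurableSpace Ω] {P : Measure Ω} {X : ℤ → Ω → ℝ} {ρ : ℤ → ℝ}

lemma allMoments (hX : IsStationaryGaussian P X ρ) (k : ℤ) : AllMoments P (X k) :=
  fun _ hp => (hX.gaussian.hasGaussianLaw_eval k).memLp hp

lemma covariance_eq (hX : IsStationaryGaussian P X ρ) (k l : ℤ) :
    cov[X k, X l; P] = ρ (k - l) := by
  have := hX.gaussian.isProbabilityMeasure
  rw [covariance_eq_sub (hX.allMoments k 2 (by simp)) (hX.allMoments l 2 (by simp)),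
    hX.centered k, hX.centered l, ← hX.cov k l]
  simp

lemma even_cov (hX : IsStationaryGaussian P X ρ) (k : ℤ) : ρ (-k) = ρ k := by
  have h1 := hX.cov 0 k
  have h2 := hX.cov k 0
  simp only [zero_sub, sub_zero] at h1 h2
  rw [← h1, ← h2]
  simp only [mul_comm]

lemma map_eq_gaussianReal (hX : IsStationaryGaussian P X ρ) (k : ℤ) :
    P.map (X k) = gaussianReal 0 1 := by
  have := hX.gaussian.isProbabilityMeasure
  have hm := hX.gaussian.aemeasurable k
  have h := (hX.gaussian.hasGaussianLaw_eval k).map_eq_gaussianReal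
  have hv : Var[X k; P] = 1 := by
    rw [← covariance_self hm, hX.covariance_eq, sub_self, hX.unit_variance]
  rw [h, hv, hX.centered]
  simp

/-- `X_k` is independent of the residuals of its linear regression on the process. -/
lemma indepFun_residual (hX : IsStationaryGaussian P X ρ) (k : ℤ) :
    IndepFun (X k) (fun ω (j : ℤ) => X j ω - ρ (j - k) * X k ω) P := by
  have := hX.gaussian.isProbabilityMeasure
  have hG : IsGaussianProcess (Sum.elim (fun (_ : Unit) => X k)
      (fun (j : ℤ) ω => X j ω - ρ (j - k) * X k ω)) P := by
    refine hX.gaussian.of_isGaussianProcess fun s => ?_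
    rcases s with _ | j
    · exact ⟨{k}, (ContinuousLinearMap.proj ⟨k, by simp⟩ : (({k} : Finset ℤ) → ℝ) →L[ℝ] ℝ), fun ω => by simp⟩
    · refine ⟨{j, k}, (ContinuousLinearMap.proj ⟨j, by simp⟩
        - ρ (j - k) • ContinuousLinearMap.proj ⟨k, by simp⟩ :
          (({j, k} : Finset ℤ) → ℝ) →L[ℝ] ℝ), fun ω => by simp⟩
  -- For jointly Gaussian families, uncorrelated means independent; here the covariance is ρ(k-j) -
  -- ρ(j-k)·1 = 0.
  have h := hG.indepFun_of_covariance_eq_zero (fun _ => hX.gaussian.aemeasurable k)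
    (fun j => (hX.gaussian.aemeasurable j).sub ((hX.gaussian.aemeasurable k).const_mul _))
    (fun _ j => by
      rw [covariance_fun_sub_right (hX.allMoments k 2 (by simp)) (hX.allMoments j 2 (by simp))
        (((hX.allMoments k).const_mul _) 2 (by simp)), covariance_const_mul_right,
        hX.covariance_eq, hX.covariance_eq, sub_self, hX.unit_variance, mul_one,
        ← hX.even_cov (j - k), neg_sub, sub_self])
  exact h.comp (by fun_prop : Measurable (fun x : Unit → ℝ => x ())) measurable_id

open Polynomial in
/-- Gaussian integration by parts for polynomials in three variables of the process. -/
lemma integral_mul_polynomials (hX : IsStationaryGaussian P X ρ) (i j k : ℤ) (A B D : ℝ[X]) :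
    ∫ ω, X i ω * (A.eval (X i ω) * B.eval (X j ω) * D.eval (X k ω)) ∂P
      = ∫ ω, (derivative A).eval (X i ω) * B.eval (X j ω) * D.eval (X k ω) ∂P
        + ρ (j - i) * ∫ ω, A.eval (X i ω) * (derivative B).eval (X j ω) * D.eval (X k ω) ∂P
        + ρ (k - i) * ∫ ω, A.eval (X i ω) * B.eval (X j ω) * (derivative D).eval (X k ω) ∂P := by
  have := hX.gaussian.isProbabilityMeasure
  set α := ρ (j - i)
  set β := ρ (k - i)
  -- Given the residuals W, the integrand is a polynomial `Q` in the single standard Gaussian X_i.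
  -- The one-variable formula applies, and the chain rule produces the factors α and β.
  let W : Ω → ℝ × ℝ := fun ω => (X j ω - α * X i ω, X k ω - β * X i ω)
  have hind : IndepFun (X i) W P :=
    (hX.indepFun_residual i).comp measurable_id
      (by fun_prop : Measurable (fun f : ℤ → ℝ => (f j, f k)))
  have hmi := hX.gaussian.aemeasurable i
  have hmW : AEMeasurable W P :=
    ((hX.gaussian.aemeasurable j).sub (hmi.const_mul _)).prodMk
      ((hX.gaussian.aemeasurable k).sub (hmi.const_mul _))
  have hprod : P.map (fun ω => (X i ω, W ω)) = (gaussianReal 0 1).prod (P.map W) := by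
    rw [(indepFun_iff_map_prod_eq_prod_map_map hmi hmW).1 hind, hX.map_eq_gaussianReal]
  let Q : ℝ × ℝ → ℝ[X] := fun w =>
    A * B.comp (C α * Polynomial.X + C w.1) * D.comp (C β * Polynomial.X + C w.2)
  have hQ : ∀ ω, (Q (W ω)).eval (X i ω) = A.eval (X i ω) * B.eval (X j ω) * D.eval (X k ω) := by
    intro ω; simp [Q, W]
  have hQ' : ∀ ω, (derivative (Q (W ω))).eval (X i ω)
      = (derivative A).eval (X i ω) * B.eval (X j ω) * D.eval (X k ω)
        + α * (A.eval (X i ω) * (derivative B).eval (X j ω) * D.eval (X k ω))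
        + β * (A.eval (X i ω) * B.eval (X j ω) * (derivative D).eval (X k ω)) := by
    intro ω; simp [Q, W, derivative_comp]; ring
  have hmom : ∀ A B D : ℝ[X], AllMoments P
      (fun ω => A.eval (X i ω) * B.eval (X j ω) * D.eval (X k ω)) := fun A B D =>
    (((hX.allMoments i).polynomial A).mul ((hX.allMoments j).polynomial B)).mul
      ((hX.allMoments k).polynomial D)
  have hfub : ∀ f : ℝ × (ℝ × ℝ) → ℝ, Continuous f → Integrable (fun ω => f (X i ω, W ω)) P →
      ∫ ω, f (X i ω, W ω) ∂P = ∫ w, ∫ x, f (x, w) ∂(gaussianReal 0 1) ∂(P.map W) := by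
    intro f hf hi
    have hm : AEMeasurable (fun ω => (X i ω, W ω)) P := hmi.prodMk hmW
    have : IsProbabilityMeasure (P.map W) := Measure.isProbabilityMeasure_map hmW
    have hi' : Integrable f ((gaussianReal 0 1).prod (P.map W)) := by
      rw [← hprod]
      exact (integrable_map_measure hf.aestronglyMeasurable hm).2 hi
    rw [← integral_prod_symm _ hi', ← hprod, integral_map hm hf.aestronglyMeasurable]
  have hI := (hmom (derivative A) B D).integrable
  have hJ := ((hmom A (derivative B) D).const_mul α).integrable
  have hK := ((hmom A B (derivative D)).const_mul β).integrable
  have hl := hfub (fun z => z.1 * (Q z.2).eval z.1)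
    (by simp only [Q, eval_mul, eval_comp, eval_add, eval_C, eval_X]; fun_prop)
    (by simp only [hQ]; exact ((hX.allMoments i).mul (hmom A B D)).integrable)
  have hr := hfub (fun z => (derivative (Q z.2)).eval z.1)
    (by
      simp only [Q, derivative_mul, derivative_comp, derivative_add, derivative_C, derivative_X,
        eval_mul, eval_comp, eval_add, eval_C, eval_X]; fun_prop)
    (by simp only [hQ']; exact (hI.add hJ).add hK)
  simp only [hQ, hQ'] at hl hr
  rw [hl]
  simp only [integral_mul_polynomial_gaussianReal]
  rw [← hr, ← integral_const_mul, ← integral_const_mul]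
  exact (integral_add (hI.add hJ) hK).trans (congrArg (· + _) (integral_add hI hJ))

/-- The mixed moment `E[H_a(X_i) H_b(X_j) H_c(X_k)]`. -/
def _root_.BreuerMajor.tripleMoment (P : Measure Ω) (X : ℤ → Ω → ℝ) (i j k : ℤ) (a b c : ℕ) : ℝ :=
  ∫ ω, H a (X i ω) * H b (X j ω) * H c (X k ω) ∂P

/-- In H_{a+1} = x H_a - H_a' the subtracted term cancels the derivative falling on H_a, leaving
only contractions with the other two variables. -/
lemma tripleMoment_succ (hX : IsStationaryGaussian P X ρ) (i j k : ℤ) (a b c : ℕ) :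
    tripleMoment P X i j k (a + 1) b c
      = ρ (j - i) * (b * tripleMoment P X i j k a (b - 1) c)
        + ρ (k - i) * (c * tripleMoment P X i j k a b (c - 1)) := by
  have := hX.gaussian.isProbabilityMeasure
  have h := hX.integral_mul_polynomials i j k (realHermite a) (realHermite b) (realHermite c)
  have hmom : ∀ A B D : Polynomial ℝ, AllMoments P
      (fun ω => A.eval (X i ω) * B.eval (X j ω) * D.eval (X k ω)) := fun A B D =>
    (((hX.allMoments i).polynomial A).mul ((hX.allMoments j).polynomial B)).mul
      ((hX.allMoments k).polynomial D)
  have e : tripleMoment P X i j k (a + 1) b c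
      = ∫ ω, X i ω * ((realHermite a).eval (X i ω) * (realHermite b).eval (X j ω)
          * (realHermite c).eval (X k ω)) ∂P
        - ∫ ω, (Polynomial.derivative (realHermite a)).eval (X i ω) * (realHermite b).eval (X j ω)
          * (realHermite c).eval (X k ω) ∂P := by
    rw [← integral_sub ((hX.allMoments i).mul (hmom _ _ _)).integrable (hmom _ _ _).integrable]
    simp only [tripleMoment, H_eq_eval, realHermite_succ, Polynomial.eval_sub,
      Polynomial.eval_mul, Polynomial.eval_X]
    congr 1; ext ω; ring
  rw [e, h]
  simp only [derivative_realHermite b, derivative_realHermite c, Polynomial.eval_mul,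
    Polynomial.eval_C, tripleMoment, H_eq_eval, ← integral_const_mul]
  ring_nf
  simp only [mul_comm, mul_left_comm, mul_assoc]

lemma tripleMoment_rotate (i j k : ℤ) (a b c : ℕ) :
    tripleMoment P X i j k a b c = tripleMoment P X j k i b c a := by
  simp only [tripleMoment]; congr 1; ext ω; ring

lemma tripleMoment_zero_succ (hX : IsStationaryGaussian P X ρ) (i j k : ℤ) (b c : ℕ) :
    tripleMoment P X i j k 0 (b + 1) c
      = ρ (k - j) * (c * tripleMoment P X i j k 0 b (c - 1)) := by
  rw [tripleMoment_rotate, hX.tripleMoment_succ, tripleMoment_rotate i j k 0 b]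
  simp

lemma tripleMoment_zero_zero_succ (hX : IsStationaryGaussian P X ρ) (i j k : ℤ) (c : ℕ) :
    tripleMoment P X i j k 0 0 (c + 1) = 0 := by
  rw [tripleMoment_rotate, tripleMoment_rotate, hX.tripleMoment_succ]
  simp

lemma tripleMoment_zero (hX : IsStationaryGaussian P X ρ) (i j k : ℤ) :
    tripleMoment P X i j k 0 0 0 = 1 := by
  have := hX.gaussian.isProbabilityMeasure
  simp [tripleMoment, H_eq_eval, realHermite_zero]

/-- Every contraction joins two different vertices, so the legs at k cannot all be paired once they
outnumber those at i and j together. -/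
lemma tripleMoment_eq_zero_right (hX : IsStationaryGaussian P X ρ) (i j k : ℤ) {a b c : ℕ}
    (h : a + b < c) : tripleMoment P X i j k a b c = 0 := by
  induction a generalizing b c with
  | zero =>
    induction b generalizing c with
    | zero =>
      obtain ⟨c, rfl⟩ : ∃ d, c = d + 1 := ⟨c - 1, by omega⟩
      exact hX.tripleMoment_zero_zero_succ i j k c
    | succ b ih => rw [hX.tripleMoment_zero_succ, ih (by omega)]; simp
  | succ a ih => rw [hX.tripleMoment_succ, ih (by omega), ih (by omega)]; simp

lemma tripleMoment_eq_zero_mid (hX : IsStationaryGaussian P X ρ) (i j k : ℤ) {a b c : ℕ}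
    (h : a + c < b) : tripleMoment P X i j k a b c = 0 := by
  induction a generalizing b c with
  | zero =>
    induction c generalizing b with
    | zero =>
      obtain ⟨b, rfl⟩ : ∃ d, b = d + 1 := ⟨b - 1, by omega⟩
      rw [hX.tripleMoment_zero_succ]; simp
    | succ c ih =>
      obtain ⟨b, rfl⟩ : ∃ d, b = d + 1 := ⟨b - 1, by omega⟩
      rw [hX.tripleMoment_zero_succ, Nat.add_sub_cancel, ih (by omega)]; simp
  | succ a ih => rw [hX.tripleMoment_succ, ih (by omega), ih (by omega)]; simp

lemma tripleMoment_zero_self (hX : IsStationaryGaussian P X ρ) (i j k : ℤ) (t : ℕ) :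
    tripleMoment P X i j k 0 t t = t ! * ρ (k - j) ^ t := by
  induction t with
  | zero => simp [hX.tripleMoment_zero]
  | succ t ih =>
    rw [hX.tripleMoment_zero_succ, Nat.add_sub_cancel, ih, Nat.factorial_succ]
    push_cast; ring

/-- The diagram formula for three Hermite polynomials of Gaussian variables. -/
lemma factorial_mul_tripleMoment (hX : IsStationaryGaussian P X ρ) (i j k : ℤ) (r s t : ℕ) :
    r ! * s ! * t ! * tripleMoment P X i j k (r + s) (r + t) (s + t)
      = (r + s)! * (r + t)! * (s + t)! * (ρ (j - i) ^ r * ρ (k - i) ^ s * ρ (k - j) ^ t) := by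
  obtain ⟨a, ha⟩ : ∃ a, a = r + s := ⟨_, rfl⟩
  induction a generalizing r s with
  | zero =>
    obtain ⟨rfl, rfl⟩ : r = 0 ∧ s = 0 := by omega
    simp [hX.tripleMoment_zero_self]; ring
  | succ a ih =>
    rcases r with _ | r <;> rcases s with _ | s
    · omega
    -- With r = 0, a contraction between i and j would leave too many legs at k, so one of the two
    -- terms vanishes.
    · have h := ih 0 s (by omega)
      rw [zero_add, add_right_comm, hX.tripleMoment_succ,
        hX.tripleMoment_eq_zero_right i j k (by omega)]
      simp only [zero_add, add_tsub_cancel_right, Nat.factorial_succ, Nat.factorial_zero,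
        pow_zero] at h ⊢
      push_cast at h ⊢
      linear_combination (s + 1 : ℝ) * ρ (k - i) * (s + t + 1) * h
    · have h := ih r 0 (by omega)
      rw [add_zero, add_right_comm, hX.tripleMoment_succ,
        hX.tripleMoment_eq_zero_mid i j k (b := r + t + 1) (by omega)]
      simp only [zero_add, add_zero, add_tsub_cancel_right, Nat.factorial_succ, Nat.factorial_zero,
        pow_zero] at h ⊢
      push_cast at h ⊢
      linear_combination (r + 1 : ℝ) * ρ (j - i) * (r + t + 1) * h
    -- After clearing factorials the two contractions contribute with weights r + 1 and s + 1, whose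
    -- sum is the new factor r + s + 2 of (r + s + 2)!.
    · have h1 := ih r (s + 1) (by omega)
      have h2 := ih (r + 1) s (by omega)
      rw [show r + 1 + (s + 1) = (r + s + 1) + 1 by ring, hX.tripleMoment_succ]
      rw [show r + (s + 1) = r + s + 1 by ring] at h1
      rw [show r + 1 + s = r + s + 1 by ring] at h2
      rw [show r + 1 + t = r + t + 1 by ring] at h2 ⊢
      rw [show s + 1 + t = s + t + 1 by ring] at h1 ⊢
      simp only [add_tsub_cancel_right, Nat.factorial_succ] at h1 h2 ⊢
      push_cast at h1 h2 ⊢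
      linear_combination (r + 1 : ℝ) * ρ (j - i) * (r + t + 1) * h1
        + (s + 1 : ℝ) * ρ (k - i) * (s + t + 1) * h2

lemma integral_H_mul_H (hX : IsStationaryGaussian P X ρ) (n : ℕ) (j k : ℤ) :
    ∫ ω, H n (X j ω) * H n (X k ω) ∂P = n ! * ρ (k - j) ^ n := by
  rw [← hX.tripleMoment_zero_self 0 j k n]
  simp [tripleMoment, H_eq_eval, realHermite_zero]

lemma integral_H (hX : IsStationaryGaussian P X ρ) {n : ℕ} (hn : n ≠ 0) (k : ℤ) :
    ∫ ω, H n (X k ω) ∂P = 0 := by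
  rw [← hX.tripleMoment_eq_zero_right 0 0 k (a := 0) (b := 0) (c := n) (by omega)]
  simp [tripleMoment, H_eq_eval, realHermite_zero]

/-- Identifies the binomial form of the constant with (2m)!³ / m!³, the value of the diagram formula
at r = s = t = m. -/
lemma _root_.BreuerMajor.d₃_mul_factorial {m : ℕ} (hm : m ≠ 0) :
    d₃ (2 * m) * m ! ^ 3 = (2 * m)! ^ 3 := by
  obtain ⟨m, rfl⟩ := Nat.exists_eq_succ_of_ne_zero hm
  have h := Nat.choose_mul_factorial_mul_factorial (n := 2 * m + 1) (k := m) (by omega)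
  rw [show 2 * m + 1 - m = m + 1 by omega] at h
  have e : (2 * m + 2)! = (2 * m + 2) * (2 * m + 1)! := Nat.factorial_succ _
  have e' : (m + 1)! = (m + 1) * m ! := Nat.factorial_succ _
  simp only [d₃, Nat.succ_eq_add_one, show 2 * (m + 1) = 2 * m + 2 by ring,
    show (2 * m + 2) / 2 - 1 = m by omega, show 2 * m + 2 - 1 = 2 * m + 1 by omega]
  calc _ = (2 * m + 2)! * (2 * m + 2) ^ 2
        * ((2 * m + 1).choose m * m ! * (m + 1)!) ^ 2 := by rw [e']; ring
    _ = _ := by rw [h, e]; ring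

lemma integral_H_mul_H_mul_H (hX : IsStationaryGaussian P X ρ) {m : ℕ} (hm : m ≠ 0) (i j k : ℤ) :
    ∫ ω, H (2 * m) (X i ω) * H (2 * m) (X j ω) * H (2 * m) (X k ω) ∂P
      = d₃ (2 * m) * (ρ (j - i) ^ m * ρ (k - i) ^ m * ρ (k - j) ^ m) := by
  have h := hX.factorial_mul_tripleMoment i j k m m m
  have hd : (d₃ (2 * m) : ℝ) * m ! ^ 3 = (2 * m)! ^ 3 := by exact_mod_cast d₃_mul_factorial hm
  have h0 : (m ! : ℝ) ^ 3 ≠ 0 := by positivity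
  rw [← two_mul] at h
  apply mul_left_cancel₀ h0
  rw [tripleMoment] at h
  linear_combination h - (ρ (j - i) ^ m * ρ (k - i) ^ m * ρ (k - j) ^ m) * hd

lemma allMoments_H (hX : IsStationaryGaussian P X ρ) (n : ℕ) (k : ℤ) :
    AllMoments P (fun ω => H n (X k ω)) := by
  have := hX.gaussian.isProbabilityMeasure
  simpa only [H_eq_eval] using (hX.allMoments k).polynomial (realHermite n)

end IsStationaryGaussian

/-! ### The third cumulant as a third moment -/

/-- The third derivative of `log φ` at a point where `φ = 1` and `φ' = 0`. -/
lemma iteratedDeriv_three_log {f : ℝ → ℂ} (hf : ContDiff ℝ 3 f) (h0 : f 0 = 1)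
    (h1 : deriv f 0 = 0) :
    iteratedDeriv 3 (fun t => Complex.log (f t)) 0 = iteratedDeriv 3 f 0 := by
  have hd0 : Differentiable ℝ f := hf.differentiable (by norm_num)
  have hd1 : Differentiable ℝ (deriv f) := by
    simpa [iteratedDeriv_one] using hf.differentiable_iteratedDeriv 1 (by norm_num)
  have hd2 : Differentiable ℝ (deriv (deriv f)) := by
    simpa [iteratedDeriv_succ, iteratedDeriv_zero] using
      hf.differentiable_iteratedDeriv 2 (by norm_num)
  have hev : ∀ᶠ t in 𝓝 (0 : ℝ), f t ∈ Complex.slitPlane :=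
    hd0.continuous.continuousAt.eventually_mem
      (Complex.isOpen_slitPlane.mem_nhds (by simp [h0]))
  have e1 : deriv (fun t => Complex.log (f t)) =ᶠ[𝓝 0] fun t => deriv f t / f t := by
    filter_upwards [hev] with t ht
    exact ((hd0 t).hasDerivAt.clog_real ht).deriv
  have e2 : deriv (fun t => deriv f t / f t) =ᶠ[𝓝 0]
      fun t => (deriv (deriv f) t * f t - deriv f t * deriv f t) / f t ^ 2 := by
    filter_upwards [hev] with t ht
    exact ((hd1 t).hasDerivAt.div (hd0 t).hasDerivAt (Complex.slitPlane_ne_zero ht)).deriv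
  have e3 : HasDerivAt
      (fun t => (deriv (deriv f) t * f t - deriv f t * deriv f t) / f t ^ 2)
      (deriv (deriv (deriv f)) 0) 0 := by
    have := ((((hd2 0).hasDerivAt.mul (hd0 0).hasDerivAt)).sub
      ((hd1 0).hasDerivAt.mul (hd1 0).hasDerivAt)).div ((hd0 0).hasDerivAt.pow 2) (by simp [h0])
    refine this.congr_deriv ?_
    simp [h0, h1]
  simp only [iteratedDeriv_succ, iteratedDeriv_zero]
  rw [((e1.deriv).trans e2).deriv_eq, e3.deriv]

/-- With zero mean, the logarithm leaves the third derivative of the characteristic function at 0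
unchanged, and (-i)³ i³ = 1. -/
lemma cumulant_three_eq_integral {Ω : Type*} [MeasurableSpace Ω] {P : Measure Ω}
    [IsProbabilityMeasure P] {Z : Ω → ℝ} (hZ : MemLp Z 3 P) (h0 : ∫ ω, Z ω ∂P = 0) :
    cumulant P 3 Z = ∫ ω, Z ω ^ 3 ∂P := by
  have hm := hZ.aestronglyMeasurable.aemeasurable
  have : IsProbabilityMeasure (P.map Z) := Measure.isProbabilityMeasure_map hm
  have hid : MemLp id ((3 : ℕ) : ℝ≥0∞) (P.map Z) := by
    rw [memLp_map_measure_iff (by fun_prop) hm]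
    simpa using hZ
  have hid1 : MemLp id ((1 : ℕ) : ℝ≥0∞) (P.map Z) := hid.mono_exponent (by norm_num)
  have hpow : ∀ n : ℕ, ∫ x, x ^ n ∂(P.map Z) = ∫ ω, Z ω ^ n ∂P := fun n =>
    integral_map hm (by fun_prop)
  rw [cumulant, iteratedDeriv_three_log (contDiff_charFun hid) (by simp)]
  · rw [iteratedDeriv_charFun_zero hid, hpow, ← mul_assoc, ← mul_pow]
    simp
  · rw [← iteratedDeriv_one, iteratedDeriv_charFun_zero hid1, hpow]
    simp [h0]

/-! ### Sums over differences of indices -/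

/-- The number of `b < n` for which `b + x` and `b + y` also lie in `[0, n)`. -/
def shiftCount (n : ℕ) (x y : ℤ) : ℕ :=
  ((Finset.range n).filter fun b : ℕ =>
    (b : ℤ) + x ∈ Set.Ico (0 : ℤ) n ∧ (b : ℤ) + y ∈ Set.Ico (0 : ℤ) n).card

/-- The proportion of `b < n` for which `b + x` and `b + y` also lie in `[0, n)`. -/
def shiftWeight (n : ℕ) (x y : ℤ) : ℝ := shiftCount n x y / n

lemma shiftCount_le (n : ℕ) (x y : ℤ) : shiftCount n x y ≤ n :=
  (Finset.card_filter_le _ _).trans (by simp)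

/-- With s = |x| + |y|, every b in [s, n - s) survives both shifts. The truncated subtraction makes
this vacuous for small n. -/
lemma le_shiftCount (n : ℕ) (x y : ℤ) :
    n - (x.natAbs + y.natAbs) - (x.natAbs + y.natAbs) ≤ shiftCount n x y := by
  rw [← Nat.card_Ico]
  refine Finset.card_le_card fun b hb => ?_
  simp only [Finset.mem_Ico, Finset.mem_filter, Finset.mem_range, Set.mem_Ico] at hb ⊢
  omega

lemma shiftWeight_nonneg (n : ℕ) (x y : ℤ) : 0 ≤ shiftWeight n x y := by
  unfold shiftWeight; positivity

lemma shiftWeight_le_one (n : ℕ) (x y : ℤ) : shiftWeight n x y ≤ 1 :=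
  div_le_one_of_le₀ (by exact_mod_cast shiftCount_le n x y) (by positivity)

lemma abs_shiftWeight_le_one (n : ℕ) (x y : ℤ) : |shiftWeight n x y| ≤ 1 :=
  (abs_of_nonneg (shiftWeight_nonneg n x y)).le.trans (shiftWeight_le_one n x y)

lemma shiftCount_eq_zero {n : ℕ} {x y : ℤ} (h : x ∉ Finset.Ioo (-(n : ℤ)) n) :
    shiftCount n x y = 0 := by
  rw [shiftCount, Finset.card_eq_zero, Finset.filter_eq_empty_iff]
  intro b hb
  simp only [Finset.mem_Ioo, Finset.mem_range, Set.mem_Ico] at *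
  omega

lemma shiftCount_comm (n : ℕ) (x y : ℤ) : shiftCount n x y = shiftCount n y x := by
  simp only [shiftCount, and_comm]

lemma shiftWeight_eq_zero {n : ℕ} {x y : ℤ} (h : x ∉ Finset.Ioo (-(n : ℤ)) n) :
    shiftWeight n x y = 0 := by
  simp [shiftWeight, shiftCount_eq_zero h]

lemma shiftWeight_comm (n : ℕ) (x y : ℤ) : shiftWeight n x y = shiftWeight n y x := by
  rw [shiftWeight, shiftCount_comm, shiftWeight]

lemma tendsto_shiftWeight (x y : ℤ) : Tendsto (fun n => shiftWeight n x y) atTop (𝓝 1) := by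
  set s : ℕ := x.natAbs + y.natAbs with hs
  have h1 : Tendsto (fun n : ℕ => 1 - (2 * s : ℝ) / n) atTop (𝓝 1) := by
    simpa using (tendsto_const_div_atTop_nhds_zero_nat (2 * s : ℝ)).const_sub 1
  refine tendsto_of_tendsto_of_tendsto_of_le_of_le' h1 tendsto_const_nhds ?_
    (Eventually.of_forall fun n => shiftWeight_le_one n x y)
  filter_upwards [eventually_gt_atTop 0] with n hn
  have hn' : (0 : ℝ) < n := by exact_mod_cast hn
  have h2 : (n : ℝ) ≤ shiftCount n x y + 2 * s := by
    have := le_shiftCount n x y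
    rw [← hs] at this
    exact_mod_cast (by omega : n ≤ shiftCount n x y + 2 * s)
  rw [shiftWeight, ← sub_nonneg]
  have : (shiftCount n x y : ℝ) / n - (1 - 2 * s / n) = (shiftCount n x y + 2 * s - n) / n := by
    field_simp; ring
  rw [this]
  exact div_nonneg (by linarith) hn'.le

lemma sum_range_sub_eq {E : Type*} [AddCommMonoid E] (F : ℤ → E) {n b : ℕ} (hb : b < n) :
    ∑ a ∈ Finset.range n, F ((a : ℤ) - b)
      = ∑ x ∈ Finset.Ioo (-(n : ℤ)) n, if (b : ℤ) + x ∈ Set.Ico (0 : ℤ) n then F x else 0 := by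
  rw [← Finset.sum_filter]
  refine Finset.sum_nbij' (fun a => (a : ℤ) - b) (fun x => (b + x).toNat) ?_ ?_ ?_ ?_ ?_
  · intro a ha
    simp only [Finset.mem_filter, Finset.mem_Ioo, Finset.mem_range, Set.mem_Ico] at *
    omega
  · intro x hx
    simp only [Finset.mem_filter, Finset.mem_Ioo, Finset.mem_range, Set.mem_Ico] at *
    omega
  · intro a ha
    simp
  · intro x hx
    simp only [Finset.mem_filter, Finset.mem_Ioo, Set.mem_Ico] at *
    omega
  · intro a ha
    rfl

/-- The second shift 0 imposes no condition, so for n ≥ 1 `shiftWeight n x 0` is the Fejér weight (1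
- |x|/n)_+. This links sums over index pairs to Fejér means. -/
lemma sum_sub_eq {R : Type*} [Semiring R] (F : ℤ → R) (n : ℕ) :
    ∑ b ∈ Finset.range n, ∑ a ∈ Finset.range n, F ((a : ℤ) - b)
      = ∑ x ∈ Finset.Ioo (-(n : ℤ)) n, shiftCount n x 0 * F x := by
  rw [Finset.sum_congr rfl fun b hb => sum_range_sub_eq F (Finset.mem_range.1 hb),
    Finset.sum_comm]
  refine Finset.sum_congr rfl fun x _ => ?_
  rw [← Finset.sum_filter, Finset.sum_const, nsmul_eq_mul]
  congr 2
  rw [shiftCount]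
  congr 1
  refine Finset.filter_congr fun b hb => ?_
  simp only [Finset.mem_range, Set.mem_Ico] at *
  omega

lemma sum_sub_sub_eq {R : Type*} [Semiring R] (G : ℤ → ℤ → R) (n : ℕ) :
    ∑ b ∈ Finset.range n, ∑ a ∈ Finset.range n, ∑ c ∈ Finset.range n, G ((a : ℤ) - b) ((c : ℤ) - b)
      = ∑ x ∈ Finset.Ioo (-(n : ℤ)) n, ∑ y ∈ Finset.Ioo (-(n : ℤ)) n,
          shiftCount n x y * G x y := by
  have : ∀ b ∈ Finset.range n,
      ∑ a ∈ Finset.range n, ∑ c ∈ Finset.range n, G ((a : ℤ) - b) ((c : ℤ) - b)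
      = ∑ x ∈ Finset.Ioo (-(n : ℤ)) n, ∑ y ∈ Finset.Ioo (-(n : ℤ)) n,
          if ((b : ℤ) + x ∈ Set.Ico (0 : ℤ) n) ∧ ((b : ℤ) + y ∈ Set.Ico (0 : ℤ) n)
            then G x y else 0 := by
    intro b hb
    rw [Finset.mem_range] at hb
    rw [Finset.sum_congr rfl fun (a : ℕ) _ => sum_range_sub_eq (fun y => G ((a : ℤ) - b) y) hb,
      sum_range_sub_eq (fun x => ∑ y ∈ Finset.Ioo (-(n : ℤ)) n,
        if (b : ℤ) + y ∈ Set.Ico (0 : ℤ) n then G x y else 0) hb]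
    refine Finset.sum_congr rfl fun x _ => ?_
    split_ifs with h
    · simp [h]
    · simp [h]
  rw [Finset.sum_congr rfl this, Finset.sum_comm]
  refine Finset.sum_congr rfl fun x _ => ?_
  rw [Finset.sum_comm]
  refine Finset.sum_congr rfl fun y _ => ?_
  rw [← Finset.sum_filter, Finset.sum_const, nsmul_eq_mul, shiftCount]

lemma tendsto_tsum_weights {ι : Type*} {F : ι → ℝ} (hF : Summable F) {θ : ℕ → ι → ℝ}
    (hθ : ∀ n i, |θ n i| ≤ 1) (hlim : ∀ i, Tendsto (fun n => θ n i) atTop (𝓝 1)) :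
    Tendsto (fun n => ∑' i, θ n i * F i) atTop (𝓝 (∑' i, F i)) := by
  refine tendsto_tsum_of_dominated_convergence hF.abs (fun i => ?_)
    (Eventually.of_forall fun n i => ?_)
  · simpa using (hlim i).mul_const (F i)
  · rw [Real.norm_eq_abs, abs_mul]
    exact mul_le_of_le_one_left (abs_nonneg _) (hθ n i)

lemma tendsto_sum_sub_div {F : ℤ → ℝ} (hF : Summable F) :
    Tendsto (fun n : ℕ => (∑ b ∈ Finset.range n, ∑ a ∈ Finset.range n, F ((a : ℤ) - b)) / n)
      atTop (𝓝 (∑' x, F x)) := by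
  refine (tendsto_tsum_weights hF (θ := fun n x => shiftWeight n x 0)
    (fun n x => abs_shiftWeight_le_one n x 0) fun x => tendsto_shiftWeight x 0).congr fun n => ?_
  rw [tsum_eq_sum fun x hx => by rw [shiftWeight_eq_zero hx, zero_mul], sum_sub_eq,
    Finset.sum_div]
  exact Finset.sum_congr rfl fun x _ => by rw [shiftWeight]; ring

lemma tendsto_sum_sub_sub_div {G : ℤ × ℤ → ℝ} (hG : Summable G) :
    Tendsto (fun n : ℕ => (∑ b ∈ Finset.range n, ∑ a ∈ Finset.range n, ∑ c ∈ Finset.range n,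
      G ((a : ℤ) - b, (c : ℤ) - b)) / n) atTop (𝓝 (∑' p, G p)) := by
  refine (tendsto_tsum_weights hG (θ := fun n p => shiftWeight n p.1 p.2)
    (fun n p => abs_shiftWeight_le_one n _ _) fun p => tendsto_shiftWeight _ _).congr fun n => ?_
  rw [tsum_eq_sum (s := Finset.Ioo (-(n : ℤ)) n ×ˢ Finset.Ioo (-(n : ℤ)) n), Finset.sum_product,
    sum_sub_sub_eq fun x y => G (x, y), Finset.sum_div]
  · refine Finset.sum_congr rfl fun x _ => ?_
    rw [Finset.sum_div]
    exact Finset.sum_congr rfl fun y _ => by rw [shiftWeight]; ring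
  · intro p hp
    rw [Finset.mem_product, not_and_or] at hp
    rcases hp with h | h
    · rw [shiftWeight_eq_zero h, zero_mul]
    · rw [shiftWeight_comm, shiftWeight_eq_zero h, zero_mul]

/-! ### The convolution inequality in `ℓ^{3/2}` -/

/-- AM-GM for √|xy|, √|yz|, √|xz|, whose product is |xyz|. -/
lemma abs_mul_mul_le (x y z : ℝ) :
    |x * y * z| ≤ (|x| ^ (3 / 2 : ℝ) * |y| ^ (3 / 2 : ℝ) + |y| ^ (3 / 2 : ℝ) * |z| ^ (3 / 2 : ℝ)
      + |x| ^ (3 / 2 : ℝ) * |z| ^ (3 / 2 : ℝ)) / 3 := by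
  have h : ∀ t : ℝ, |t| ^ (3 / 2 : ℝ) = √|t| ^ 3 := by
    intro t
    rw [Real.sqrt_eq_rpow, ← Real.rpow_natCast, ← Real.rpow_mul (abs_nonneg t)]
    norm_num
  have h2 : ∀ t : ℝ, |t| = √|t| ^ 2 := fun t => (Real.sq_sqrt (abs_nonneg t)).symm
  rw [h, h, h, abs_mul, abs_mul]
  nth_rewrite 1 [h2 x, h2 y, h2 z]
  have hα := mul_nonneg (Real.sqrt_nonneg |x|) (Real.sqrt_nonneg |y|)
  have hβ := mul_nonneg (Real.sqrt_nonneg |y|) (Real.sqrt_nonneg |z|)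
  have hγ := mul_nonneg (Real.sqrt_nonneg |x|) (Real.sqrt_nonneg |z|)
  have amgm : ∀ α β γ : ℝ, 0 ≤ α → 0 ≤ β → 0 ≤ γ → α * β * γ ≤ (α ^ 3 + β ^ 3 + γ ^ 3) / 3 := by
    intro α β γ h1 h2 h3
    -- This product equals 2(α³ + β³ + γ³ - 3αβγ).
    have h4 : 0 ≤ (α + β + γ) * ((α - β) ^ 2 + (β - γ) ^ 2 + (α - γ) ^ 2) := by positivity
    nlinarith
  have := amgm _ _ _ hα hβ hγ
  calc _ = √|x| * √|y| * (√|y| * √|z|) * (√|x| * √|z|) := by ring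
    _ ≤ _ := this
    _ = _ := by ring

/-- Each product given by AM-GM involves two differences with a common index. Fixing that index
factorizes the double sum into two sums bounded by U; evenness lets all three cases reduce to `h2`.
-/
lemma sum_mul_mul_le (f : ℤ → ℝ) (hf : ∀ k, f (-k) = f k) (n : ℕ) :
    ∑ b ∈ Finset.range n, ∑ a ∈ Finset.range n, ∑ c ∈ Finset.range n,
      f ((a : ℤ) - b) * f ((c : ℤ) - b) * f ((c : ℤ) - a)
      ≤ n * (∑ k ∈ Finset.Ioo (-(n : ℤ)) n, |f k| ^ (3 / 2 : ℝ)) ^ 2 := by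
  set u : ℤ → ℝ := fun k => |f k| ^ (3 / 2 : ℝ) with hu
  set U := ∑ k ∈ Finset.Ioo (-(n : ℤ)) n, u k
  have hu0 : ∀ k, 0 ≤ u k := fun k => by positivity
  have hue : ∀ k l : ℤ, u (k - l) = u (l - k) := fun k l => by
    simp only [hu]; rw [← hf, neg_sub]
  have hU0 : 0 ≤ U := Finset.sum_nonneg fun k _ => hu0 k
  have h1 : ∀ b ∈ Finset.range n, ∑ a ∈ Finset.range n, u ((a : ℤ) - b) ≤ U := by
    intro b hb
    rw [sum_range_sub_eq u (Finset.mem_range.1 hb)]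
    refine Finset.sum_le_sum fun x _ => ?_
    split_ifs
    · exact le_rfl
    · exact hu0 x
  have h2 : ∑ b ∈ Finset.range n, ∑ a ∈ Finset.range n, ∑ c ∈ Finset.range n,
      u ((a : ℤ) - b) * u ((c : ℤ) - b) ≤ n * U ^ 2 := by
    calc _ = ∑ b ∈ Finset.range n, (∑ a ∈ Finset.range n, u ((a : ℤ) - b)) ^ 2 := by
          simp only [sq, Finset.sum_mul_sum]
      _ ≤ ∑ b ∈ Finset.range n, U ^ 2 := by
          refine Finset.sum_le_sum fun b hb => ?_
          exact pow_le_pow_left₀ (Finset.sum_nonneg fun _ _ => hu0 _) (h1 b hb) 2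
      _ = n * U ^ 2 := by simp
  calc _ ≤ ∑ b ∈ Finset.range n, ∑ a ∈ Finset.range n, ∑ c ∈ Finset.range n,
        (u ((a : ℤ) - b) * u ((c : ℤ) - b) + u ((c : ℤ) - b) * u ((c : ℤ) - a)
          + u ((a : ℤ) - b) * u ((c : ℤ) - a)) / 3 := by
        refine Finset.sum_le_sum fun b _ => Finset.sum_le_sum fun a _ =>
          Finset.sum_le_sum fun c _ => (le_abs_self _).trans (abs_mul_mul_le _ _ _)
    _ = (∑ b ∈ Finset.range n, ∑ a ∈ Finset.range n, ∑ c ∈ Finset.range n,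
          u ((a : ℤ) - b) * u ((c : ℤ) - b)
        + ∑ b ∈ Finset.range n, ∑ a ∈ Finset.range n, ∑ c ∈ Finset.range n,
          u ((c : ℤ) - b) * u ((c : ℤ) - a)
        + ∑ b ∈ Finset.range n, ∑ a ∈ Finset.range n, ∑ c ∈ Finset.range n,
          u ((a : ℤ) - b) * u ((c : ℤ) - a)) / 3 := by
        simp only [← Finset.sum_add_distrib, Finset.sum_div]
    _ ≤ (n * U ^ 2 + n * U ^ 2 + n * U ^ 2) / 3 := by
        gcongr
        · calc _ = ∑ c ∈ Finset.range n, ∑ b ∈ Finset.range n, ∑ a ∈ Finset.range n,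
                u ((b : ℤ) - c) * u ((a : ℤ) - c) := by
                rw [Finset.sum_congr rfl fun b _ => Finset.sum_comm, Finset.sum_comm]
                refine Finset.sum_congr rfl fun c _ => Finset.sum_congr rfl fun b _ =>
                  Finset.sum_congr rfl fun a _ => ?_
                rw [hue c b, hue c a]
            _ ≤ _ := h2
        · calc _ = ∑ a ∈ Finset.range n, ∑ b ∈ Finset.range n, ∑ c ∈ Finset.range n,
                u ((b : ℤ) - a) * u ((c : ℤ) - a) := by
                rw [Finset.sum_comm]
                refine Finset.sum_congr rfl fun a _ => Finset.sum_congr rfl fun b _ =>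
                  Finset.sum_congr rfl fun c _ => ?_
                rw [hue a b]
            _ ≤ _ := h2
    _ = _ := by ring

/-- The three AM-GM majorants are carried onto u(x)u(y) by shears of ℤ². -/
lemma summable_mul_mul {f : ℤ → ℝ} (hf : Summable fun k => |f k| ^ (3 / 2 : ℝ)) :
    Summable fun p : ℤ × ℤ => f p.1 * f p.2 * f (p.2 - p.1) := by
  set u : ℤ → ℝ := fun k => |f k| ^ (3 / 2 : ℝ) with hu
  have hu0 : ∀ k, 0 ≤ u k := fun k => by positivity
  have hA : Summable fun p : ℤ × ℤ => u p.1 * u p.2 := hf.mul_of_nonneg hf hu0 hu0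
  have hB : Summable fun p : ℤ × ℤ => u p.2 * u (p.2 - p.1) := by
    let e : ℤ × ℤ ≃ ℤ × ℤ :=
      { toFun := fun p => (p.2, p.2 - p.1), invFun := fun p => (p.1 - p.2, p.1)
        left_inv := fun p => by simp, right_inv := fun p => by simp }
    exact e.summable_iff.2 hA
  have hC : Summable fun p : ℤ × ℤ => u p.1 * u (p.2 - p.1) := by
    let e : ℤ × ℤ ≃ ℤ × ℤ :=
      { toFun := fun p => (p.1, p.2 - p.1), invFun := fun p => (p.1, p.1 + p.2)
        left_inv := fun p => by simp, right_inv := fun p => by simp }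
    exact e.summable_iff.2 hA
  exact Summable.of_norm_bounded (((hA.add hB).add hC).div_const 3) fun p => abs_mul_mul_le _ _ _

lemma summable_sq_of_summable_rpow {f : ℤ → ℝ} (hf : Summable fun k => |f k| ^ (3 / 2 : ℝ)) :
    Summable fun k => f k ^ 2 := by
  refine Summable.of_norm_bounded_eventually hf ?_
  have h := hf.tendsto_cofinite_zero.eventually (gt_mem_nhds one_pos)
  filter_upwards [h] with k hk
  have h1 : |f k| < 1 := by
    by_contra! hc
    exact absurd hk (not_lt.2 (Real.one_le_rpow hc (by norm_num)))
  rw [norm_pow, Real.norm_eq_abs, ← Real.rpow_natCast]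
  exact Real.rpow_le_rpow_of_exponent_ge' (abs_nonneg _) h1.le (by norm_num) (by norm_num)

open scoped ComplexConjugate

/-- Fatou's lemma for Bochner integrals of nonnegative functions. -/
lemma integrable_and_integral_le_of_tendsto {α : Type*} [MeasurableSpace α] {μ : Measure α}
    {s : ℕ → α → ℝ} {h : α → ℝ} {S : ℝ} (hs : ∀ n, Integrable (s n) μ) (hs0 : ∀ n t, 0 ≤ s n t)
    (hlim : ∀ᵐ t ∂μ, Tendsto (fun n => s n t) atTop (𝓝 (h t)))
    (hS : Tendsto (fun n => ∫ t, s n t ∂μ) atTop (𝓝 S)) :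
    Integrable h μ ∧ ∫ t, h t ∂μ ≤ S := by
  have hm : AEStronglyMeasurable h μ :=
    aestronglyMeasurable_of_tendsto_ae atTop (fun n => (hs n).aestronglyMeasurable) hlim
  have h0 : 0 ≤ᵐ[μ] h := by
    filter_upwards [hlim] with t ht
    exact ge_of_tendsto' ht fun n => hs0 n t
  have hS0 : 0 ≤ S := ge_of_tendsto' hS fun n => integral_nonneg (hs0 n)
  have hle : ∫⁻ t, ENNReal.ofReal (h t) ∂μ ≤ ENNReal.ofReal S := by
    calc ∫⁻ t, ENNReal.ofReal (h t) ∂μ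
        = ∫⁻ t, liminf (fun n => ENNReal.ofReal (s n t)) atTop ∂μ := by
          refine lintegral_congr_ae ?_
          filter_upwards [hlim] with t ht
          exact (((ENNReal.continuous_ofReal.tendsto _).comp ht).liminf_eq).symm
      _ ≤ liminf (fun n => ∫⁻ t, ENNReal.ofReal (s n t) ∂μ) atTop :=
          lintegral_liminf_le' fun n => (hs n).aemeasurable.ennreal_ofReal
      _ = ENNReal.ofReal S := by
          refine Tendsto.liminf_eq ?_
          simp only [← ofReal_integral_eq_lintegral_ofReal (hs _) (ae_of_all _ (hs0 _))]
          exact (ENNReal.continuous_ofReal.tendsto _).comp hS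
  refine ⟨⟨hm, ?_⟩, ?_⟩
  · rw [hasFiniteIntegral_iff_ofReal h0]
    exact hle.trans_lt ENNReal.ofReal_lt_top
  · rw [integral_eq_lintegral_of_nonneg_ae h0 hm]
    exact (ENNReal.toReal_mono ENNReal.ofReal_ne_top hle).trans (ENNReal.toReal_ofReal hS0).le

/-- The normalized Haar measure of the torus. -/
local notation "haar" => (AddCircle.haarAddCircle : Measure Torus)

/-! ### Square-summable Fourier series -/

section L2

variable {f : ℤ → ℝ}

lemma memℓp_coe (hf : Summable fun k => f k ^ 2) : Memℓp (fun k => (f k : ℂ)) 2 :=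
  memℓp_gen (by simpa using hf)

lemma hasSum_fourierTerm (hf : Summable fun k => f k ^ 2) :
    HasSum (fourierTerm f)
      (fourierBasis.repr.symm (⟨fun k => (f k : ℂ), memℓp_coe hf⟩ : lp (fun _ : ℤ => ℂ) 2)) := by
  have h := HilbertBasis.hasSum_repr_symm (fourierBasis (T := 2 * π))
    (⟨fun k => (f k : ℂ), memℓp_coe hf⟩ : lp (fun _ : ℤ => ℂ) 2)
  rw [coe_fourierBasis] at h
  exact h

lemma summable_fourierTerm (hf : Summable fun k => f k ^ 2) : Summable (fourierTerm f) :=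
  (hasSum_fourierTerm hf).summable

lemma repr_fourierSum (hf : Summable fun k => f k ^ 2) (k : ℤ) :
    fourierBasis.repr (fourierSum f) k = f k := by
  rw [fourierSum, (hasSum_fourierTerm hf).tsum_eq, LinearIsometryEquiv.apply_symm_apply]

lemma fourierCoeff_fourierSum (hf : Summable fun k => f k ^ 2) (k : ℤ) :
    fourierCoeff (fourierSum f) k = f k := by
  rw [← fourierBasis_repr, repr_fourierSum hf]

/-- The `n`-th Fejér mean of the Fourier series with coefficients `f`. -/
def fejer (f : ℤ → ℝ) (n : ℕ) (t : Torus) : ℂ :=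
  ∑ x ∈ Finset.Ioo (-(n : ℤ)) n, ((shiftWeight n x 0 * f x : ℝ) : ℂ) * fourier x t

/-- The `n`-th Fejér mean as an element of `L²`. -/
def fejerLp (f : ℤ → ℝ) (n : ℕ) : Lp ℂ 2 haar :=
  ∑ x ∈ Finset.Ioo (-(n : ℤ)) n, ((shiftWeight n x 0 * f x : ℝ) : ℂ) • fourierLp 2 x

lemma continuous_fejer (f : ℤ → ℝ) (n : ℕ) : Continuous (fejer f n) :=
  continuous_finsetSum _ fun x _ => continuous_const.mul (map_continuous (fourier x))

lemma coeFn_fejerLp (f : ℤ → ℝ) (n : ℕ) : fejerLp f n =ᵐ[haar] fejer f n := by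
  have h1 : ∀ x : ℤ, ∀ᵐ t ∂haar, (fourierLp 2 x : Lp ℂ 2 haar) t = fourier x t :=
    fun x => coeFn_fourierLp 2 x
  have h2 : ∀ x : ℤ, ∀ᵐ t ∂haar,
      ((((shiftWeight n x 0 * f x : ℝ) : ℂ) • fourierLp 2 x : Lp ℂ 2 haar)) t
        = ((shiftWeight n x 0 * f x : ℝ) : ℂ) * (fourierLp 2 x : Lp ℂ 2 haar) t :=
    fun x => Lp.coeFn_smul _ _
  have h3 := Lp.coeFn_finsetSum (Finset.Ioo (-(n : ℤ)) n)
    (fun x => (((shiftWeight n x 0 * f x : ℝ) : ℂ) • fourierLp 2 x : Lp ℂ 2 haar))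
  filter_upwards [h3, ae_all_iff.2 h1, ae_all_iff.2 h2] with t ht3 ht1 ht2
  rw [fejerLp, ht3, fejer]
  simp only [Finset.sum_apply, ht1, ht2]

lemma repr_fejerLp (f : ℤ → ℝ) (n : ℕ) (k : ℤ) :
    fourierBasis.repr (fejerLp f n) k = ((shiftWeight n k 0 * f k : ℝ) : ℂ) := by
  rw [HilbertBasis.repr_apply_apply, coe_fourierBasis, fejerLp, inner_sum]
  simp only [inner_smul_right, orthonormal_iff_ite.1 orthonormal_fourier k, mul_ite, mul_one,
    mul_zero, Finset.sum_ite_eq]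
  split_ifs with h
  · rfl
  · simp [shiftWeight_eq_zero h]

lemma fourierCoeff_fejer (f : ℤ → ℝ) (n : ℕ) (k : ℤ) :
    fourierCoeff (fejer f n) k = ((shiftWeight n k 0 * f k : ℝ) : ℂ) := by
  rw [← fourierCoeff_congr_ae (coeFn_fejerLp f n), ← fourierBasis_repr, repr_fejerLp]

/-- By Parseval the squared distance is ∑ (1 - w_n(k))² f(k)², where w_n(k) is the Fejér weight;
dominated convergence finishes. -/
lemma tendsto_fejerLp (hf : Summable fun k => f k ^ 2) :
    Tendsto (fejerLp f) atTop (𝓝 (fourierSum f)) := by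
  rw [tendsto_iff_norm_sub_tendsto_zero]
  have h : ∀ n, ‖fejerLp f n - fourierSum f‖ ^ 2
      = ∑' k, (1 - shiftWeight n k 0) ^ 2 * f k ^ 2 := by
    intro n
    have h1 := lp.hasSum_norm (p := 2) (by norm_num)
      (fourierBasis.repr (fejerLp f n - fourierSum f))
    rw [LinearIsometryEquiv.norm_map] at h1
    simp only [map_sub, lp.coeFn_sub, Pi.sub_apply, repr_fejerLp, repr_fourierSum hf] at h1
    have h2 := h1.tsum_eq
    simp only [ENNReal.toReal_ofNat, Real.rpow_ofNat] at h2
    rw [← h2]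
    refine tsum_congr fun k => ?_
    rw [← Complex.ofReal_sub, Complex.norm_real, Real.norm_eq_abs, sq_abs]
    ring
  have h3 : Tendsto (fun n => ‖fejerLp f n - fourierSum f‖ ^ 2) atTop (𝓝 0) := by
    simp only [h]
    have : Tendsto (fun n => ∑' k, (1 - shiftWeight n k 0) ^ 2 * f k ^ 2) atTop
        (𝓝 (∑' _ : ℤ, (0 : ℝ))) := by
      refine tendsto_tsum_of_dominated_convergence hf (fun k => ?_)
        (Eventually.of_forall fun n k => ?_)
      · simpa using (((tendsto_shiftWeight k 0).const_sub 1).pow 2).mul_const (f k ^ 2)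
      · rw [Real.norm_of_nonneg (by positivity)]
        refine mul_le_of_le_one_left (sq_nonneg _) ?_
        have h1 := shiftWeight_nonneg n k 0
        have h2 := shiftWeight_le_one n k 0
        nlinarith
    simpa using this
  have := (Real.continuous_sqrt.tendsto 0).comp h3
  simpa [Function.comp_def, Real.sqrt_sq (norm_nonneg _)] using this

lemma exists_seq_tendsto_fejer (hf : Summable fun k => f k ^ 2) :
    ∃ ns : ℕ → ℕ, StrictMono ns ∧
      ∀ᵐ t ∂haar, Tendsto (fun i => fejer f (ns i) t) atTop (𝓝 (fourierSum f t)) := by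
  obtain ⟨ns, hns, h⟩ := (tendstoInMeasure_of_tendsto_Lp (tendsto_fejerLp hf)).exists_seq_tendsto_ae
  refine ⟨ns, hns, ?_⟩
  filter_upwards [h, ae_all_iff.2 fun n => coeFn_fejerLp f n] with t ht h2
  simpa only [h2] using ht

/-- Expanding conj σ_n · σ_n yields characters of frequency y - x, and integrating them against h
reads off a Fourier coefficient. The conjugate is harmless later, when σ_n is real. -/
lemma integral_mul_conj_fejer_mul_fejer (f : ℤ → ℝ) (n : ℕ) {h : Torus → ℂ}
    (hh : Integrable h haar) :
    ∫ t, h t * conj (fejer f n t) * fejer f n t ∂haar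
      = ∑ x ∈ Finset.Ioo (-(n : ℤ)) n, ∑ y ∈ Finset.Ioo (-(n : ℤ)) n,
        ((shiftWeight n x 0 * f x : ℝ) : ℂ) * ((shiftWeight n y 0 * f y : ℝ) : ℂ)
          * fourierCoeff h (x - y) := by
  have e : ∀ t, h t * conj (fejer f n t) * fejer f n t
      = ∑ x ∈ Finset.Ioo (-(n : ℤ)) n, ∑ y ∈ Finset.Ioo (-(n : ℤ)) n,
        ((shiftWeight n x 0 * f x : ℝ) : ℂ) * ((shiftWeight n y 0 * f y : ℝ) : ℂ)
          * (fourier (-(x - y)) t • h t) := by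
    intro t
    simp only [fejer, map_sum, map_mul, Complex.conj_ofReal, ← fourier_neg, Finset.mul_sum,
      Finset.sum_mul]
    rw [Finset.sum_comm]
    refine Finset.sum_congr rfl fun x _ => Finset.sum_congr rfl fun y _ => ?_
    rw [show -(x - y) = -x + y by ring, fourier_add, smul_eq_mul]
    ring
  simp only [e]
  have hi : ∀ x y : ℤ, Integrable (fun t => ((shiftWeight n x 0 * f x : ℝ) : ℂ)
      * ((shiftWeight n y 0 * f y : ℝ) : ℂ) * (fourier (-(x - y)) t • h t)) haar :=
    fun x y => (hh.fourier_smul _).const_mul _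
  rw [integral_finsetSum _ fun x _ => integrable_finsetSum _ fun y _ => hi x y]
  refine Finset.sum_congr rfl fun x _ => ?_
  rw [integral_finsetSum _ fun y _ => hi x y]
  refine Finset.sum_congr rfl fun y _ => ?_
  rw [integral_const_mul, fourierCoeff]

end L2

/-! ### Positive definite coefficients -/

/-- Positive definite real sequences, tested on finitely many consecutive indices. -/
structure IsPosDefSeq (f : ℤ → ℝ) : Prop where
  even : ∀ k, f (-k) = f k
  nonneg : ∀ (n : ℕ) (x : ℕ → ℝ),
    0 ≤ ∑ b ∈ Finset.range n, ∑ a ∈ Finset.range n, f ((a : ℤ) - b) * (x a * x b)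

/-! ### Nonnegative Fejér means and the integral of the cube -/

namespace IsPosDefSeq

variable {f : ℤ → ℝ}

/-- Exhibits the Fejér mean as a Hermitian form of the Toeplitz matrix f(a-b), evaluated on the
vector of characters; its reality and sign follow. -/
lemma fejer_eq (f : ℤ → ℝ) (n : ℕ) (t : Torus) :
    fejer f n t = (∑ b ∈ Finset.range n, ∑ a ∈ Finset.range n,
      (f ((a : ℤ) - b) : ℂ) * (fourier (a : ℤ) t * conj (fourier (b : ℤ) t : ℂ))) / n := by
  have := sum_sub_eq (fun x : ℤ => (f x : ℂ) * fourier x t) n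
  simp only [sub_eq_add_neg _ ((_ : ℕ) : ℤ), fourier_add, fourier_neg] at this ⊢
  rw [this, fejer, Finset.sum_div]
  refine Finset.sum_congr rfl fun x _ => ?_
  rw [shiftWeight]
  push_cast
  ring

lemma fejer_im (hf : IsPosDefSeq f) (n : ℕ) (t : Torus) : (fejer f n t).im = 0 := by
  rw [← Complex.conj_eq_iff_im, fejer_eq]
  simp only [map_div₀, map_sum, map_mul, Complex.conj_ofReal, Complex.conj_conj, Complex.conj_natCast]
  congr 1
  rw [Finset.sum_comm]
  refine Finset.sum_congr rfl fun b _ => Finset.sum_congr rfl fun a _ => ?_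
  rw [← hf.even, neg_sub, mul_comm (conj _)]

lemma fejer_re_nonneg (hf : IsPosDefSeq f) (n : ℕ) (t : Torus) : 0 ≤ (fejer f n t).re := by
  rw [fejer_eq, Complex.div_natCast_re]
  refine div_nonneg ?_ (Nat.cast_nonneg n)
  -- Positivity is assumed for real vectors only, so real and imaginary parts of the characters are
  -- tested separately.
  have h1 := hf.nonneg n fun a => (fourier (a : ℤ) t : ℂ).re
  have h2 := hf.nonneg n fun a => (fourier (a : ℤ) t : ℂ).im
  refine (add_nonneg h1 h2).trans_eq ?_
  simp only [← Finset.sum_add_distrib, Complex.re_sum]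
  refine Finset.sum_congr rfl fun b _ => Finset.sum_congr rfl fun a _ => ?_
  rw [Complex.re_ofReal_mul]
  simp only [Complex.mul_re, Complex.conj_re, Complex.conj_im]
  ring

lemma fejer_eq_ofReal (hf : IsPosDefSeq f) (n : ℕ) (t : Torus) :
    fejer f n t = ((fejer f n t).re : ℂ) := by
  apply Complex.ext <;> simp [hf.fejer_im]

lemma ae_im_eq_zero_and_re_nonneg (hf : IsPosDefSeq f) (hs : Summable fun k => f k ^ 2) :
    ∀ᵐ t ∂haar, (fourierSum f t).im = 0 ∧ 0 ≤ (fourierSum f t).re := by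
  obtain ⟨ns, -, h⟩ := exists_seq_tendsto_fejer hs
  filter_upwards [h] with t ht
  constructor
  · have := (Complex.continuous_im.tendsto _).comp ht
    simp only [Function.comp_def, hf.fejer_im] at this
    exact tendsto_nhds_unique this tendsto_const_nhds
  · exact ge_of_tendsto' ((Complex.continuous_re.tendsto _).comp ht)
      fun n => hf.fejer_re_nonneg _ t

lemma integrable_sq (hf : IsPosDefSeq f) (hs : Summable fun k => f k ^ 2) :
    Integrable (fun t => (fourierSum f t).re ^ 2) haar := by
  have h := (Lp.memLp (fourierSum f)).integrable_norm_pow (by norm_num)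
  refine h.congr ?_
  filter_upwards [hf.ae_im_eq_zero_and_re_nonneg hs] with t ht
  rw [Complex.sq_norm, Complex.normSq_apply, ht.1]
  ring

lemma integral_sq (hf : IsPosDefSeq f) (hs : Summable fun k => f k ^ 2) :
    ∫ t, (fourierSum f t).re ^ 2 ∂haar = ∑' k, f k ^ 2 := by
  have h := (hasSum_sq_fourierCoeff (fourierSum f)).tsum_eq
  simp only [fourierCoeff_fourierSum hs, Complex.norm_real, Real.norm_eq_abs, sq_abs] at h
  rw [h]
  refine integral_congr_ae ?_
  filter_upwards [hf.ae_im_eq_zero_and_re_nonneg hs] with t ht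
  rw [Complex.sq_norm, Complex.normSq_apply, ht.1]
  ring

/-- Serves two cases: r = σ_n, with θ the Fejér weight, and r = g, with θ = 1. -/
lemma integral_mul_fejer_sq (hf : IsPosDefSeq f) (n : ℕ) {r : Torus → ℝ} {h : Torus → ℂ}
    (hh : Integrable h haar) (hr : ∀ᵐ t ∂haar, h t = r t) {θ : ℤ → ℝ}
    (hθ : ∀ k, fourierCoeff h k = ((θ k * f k : ℝ) : ℂ)) :
    ∫ t, r t * (fejer f n t).re ^ 2 ∂haar
      = ∑' p : ℤ × ℤ, (shiftWeight n p.1 0 * shiftWeight n p.2 0 * θ (p.1 - p.2))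
          * (f p.1 * f p.2 * f (p.2 - p.1)) := by
  apply Complex.ofReal_injective
  calc ((∫ t, r t * (fejer f n t).re ^ 2 ∂haar : ℝ) : ℂ)
      = ∫ t, h t * conj (fejer f n t) * fejer f n t ∂haar := by
        rw [← integral_complex_ofReal]
        refine integral_congr_ae ?_
        filter_upwards [hr] with t ht
        rw [ht, hf.fejer_eq_ofReal n t, Complex.conj_ofReal, Complex.ofReal_re]
        push_cast
        ring
    _ = _ := by
        rw [integral_mul_conj_fejer_mul_fejer f n hh,
          tsum_eq_sum (s := Finset.Ioo (-(n : ℤ)) n ×ˢ Finset.Ioo (-(n : ℤ)) n),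
          Finset.sum_product]
        · push_cast
          refine Finset.sum_congr rfl fun x _ => Finset.sum_congr rfl fun y _ => ?_
          rw [hθ, ← hf.even (x - y), neg_sub]
          push_cast
          ring
        · intro p hp
          rw [Finset.mem_product, not_and_or] at hp
          rcases hp with h | h <;> rw [shiftWeight_eq_zero h] <;> ring

/-- The sum `∑_{x, y} f(x) f(y) f(y - x)`. -/
def _root_.BreuerMajor.tripleSum (f : ℤ → ℝ) : ℝ := ∑' p : ℤ × ℤ, f p.1 * f p.2 * f (p.2 - p.1)

lemma integrable_fejer_pow (f : ℤ → ℝ) (n k : ℕ) :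
    Integrable (fun t => (fejer f n t).re ^ k) haar :=
  Continuous.integrable_of_hasCompactSupport
    ((Complex.continuous_re.comp (continuous_fejer f n)).pow k) (HasCompactSupport.of_compactSpace _)

lemma tendsto_integral_fejer_cube (hf : IsPosDefSeq f)
    (hs : Summable fun k => |f k| ^ (3 / 2 : ℝ)) :
    Tendsto (fun n => ∫ t, (fejer f n t).re ^ 3 ∂haar) atTop (𝓝 (tripleSum f)) := by
  have h := tendsto_tsum_weights (summable_mul_mul hs)
    (θ := fun n p => shiftWeight n p.1 0 * shiftWeight n p.2 0 * shiftWeight n (p.1 - p.2) 0)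
    (fun n p => by
      rw [abs_mul, abs_mul]
      exact mul_le_one₀ (mul_le_one₀ (abs_shiftWeight_le_one _ _ _) (abs_nonneg _)
        (abs_shiftWeight_le_one _ _ _)) (abs_nonneg _) (abs_shiftWeight_le_one _ _ _))
    (fun p => by
      simpa using ((tendsto_shiftWeight p.1 0).mul (tendsto_shiftWeight p.2 0)).mul
        (tendsto_shiftWeight (p.1 - p.2) 0))
  refine h.congr fun n => ?_
  rw [← hf.integral_mul_fejer_sq n (r := fun t => (fejer f n t).re)
    ((continuous_fejer f n).integrable_of_hasCompactSupport (HasCompactSupport.of_compactSpace _))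
    (ae_of_all _ (hf.fejer_eq_ofReal n)) (θ := fun k => shiftWeight n k 0) (fourierCoeff_fejer f n)]
  refine integral_congr_ae (ae_of_all _ fun t => ?_)
  simp only
  ring

lemma tendsto_integral_mul_fejer_sq (hf : IsPosDefSeq f)
    (hs : Summable fun k => |f k| ^ (3 / 2 : ℝ)) :
    Tendsto (fun n => ∫ t, (fourierSum f t).re * (fejer f n t).re ^ 2 ∂haar) atTop
      (𝓝 (tripleSum f)) := by
  have hs2 := summable_sq_of_summable_rpow hs
  have h := tendsto_tsum_weights (summable_mul_mul hs)
    (θ := fun n p => shiftWeight n p.1 0 * shiftWeight n p.2 0 * 1)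
    (fun n p => by
      rw [mul_one, abs_mul]
      exact mul_le_one₀ (abs_shiftWeight_le_one _ _ _) (abs_nonneg _)
        (abs_shiftWeight_le_one _ _ _))
    (fun p => by
      simpa using (tendsto_shiftWeight p.1 0).mul (tendsto_shiftWeight p.2 0))
  refine h.congr fun n => ?_
  rw [hf.integral_mul_fejer_sq n (r := fun t => (fourierSum f t).re) (h := fourierSum f)
    ((Lp.memLp (fourierSum f)).integrable (by norm_num)) (θ := fun _ => 1)
    (by
      filter_upwards [hf.ae_im_eq_zero_and_re_nonneg hs2] with t ht
      apply Complex.ext <;> simp [ht.1])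
    (fun k => by rw [fourierCoeff_fourierSum hs2, one_mul])]

/-- Fatou gives integrability and one inequality. For the other, the mixed integral ∫ g σ_n² has the
same limit as ∫ σ_n³ and is controlled by AM-GM, so no convergence in L³ is needed. -/
lemma integrable_cube_and_integral_cube (hf : IsPosDefSeq f)
    (hs : Summable fun k => |f k| ^ (3 / 2 : ℝ)) :
    Integrable (fun t => (fourierSum f t).re ^ 3) haar ∧
      ∫ t, (fourierSum f t).re ^ 3 ∂haar = tripleSum f := by
  have hs2 := summable_sq_of_summable_rpow hs
  have hA := hf.tendsto_integral_fejer_cube hs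
  obtain ⟨ns, hns, hlim⟩ := exists_seq_tendsto_fejer hs2
  obtain ⟨hint, hle⟩ := integrable_and_integral_le_of_tendsto
    (s := fun i t => (fejer f (ns i) t).re ^ 3) (h := fun t => (fourierSum f t).re ^ 3)
    (fun i => integrable_fejer_pow f _ 3) (fun i t => pow_nonneg (hf.fejer_re_nonneg _ t) 3)
    (by
      filter_upwards [hlim] with t ht
      exact ((Complex.continuous_re.tendsto _).comp ht).pow 3)
    (hA.comp hns.tendsto_atTop)
  refine ⟨hint, le_antisymm hle ?_⟩
  have hamgm : ∀ n, 3 * ∫ t, (fourierSum f t).re * (fejer f n t).re ^ 2 ∂haar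
      ≤ ∫ t, (fourierSum f t).re ^ 3 ∂haar + 2 * ∫ t, (fejer f n t).re ^ 3 ∂haar := by
    intro n
    have hi := (integrable_fejer_pow f n 3).const_mul 2
    rw [← integral_const_mul, ← integral_const_mul, ← integral_add hint hi]
    refine integral_mono_of_nonneg ?_ (hint.add hi) ?_
    · filter_upwards [hf.ae_im_eq_zero_and_re_nonneg hs2] with t ht
      have := ht.2
      simp only [Pi.zero_apply]
      positivity
    · filter_upwards [hf.ae_im_eq_zero_and_re_nonneg hs2] with t ht
      have h1 := ht.2
      have h2 := hf.fejer_re_nonneg n t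
      generalize (fourierSum f t).re = x at h1
      generalize (fejer f n t).re = y at h2
      -- The product expands to x³ - 3xy² + 2y³.
      have h3 : 0 ≤ (x + 2 * y) * (x - y) ^ 2 := by positivity
      nlinarith
  have := le_of_tendsto_of_tendsto' ((hf.tendsto_integral_mul_fejer_sq hs).const_mul 3)
    ((hA.const_mul 2).const_add _) hamgm
  linarith

end IsPosDefSeq

namespace IsStationaryGaussian

variable {Ω : Type*} [MeasurableSpace Ω] {P : Measure Ω} {X : ℤ → Ω → ℝ} {ρ : ℤ → ℝ}

/-! ### Moments of `V_n` -/

lemma allMoments_V (hX : IsStationaryGaussian P X ρ) (q n : ℕ) : AllMoments P (V X q n) :=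
  (AllMoments.sum _ fun (k : ℕ) _ => hX.allMoments_H q k).const_mul _

lemma integral_V (hX : IsStationaryGaussian P X ρ) {q : ℕ} (hq : q ≠ 0) (n : ℕ) :
    ∫ ω, V X q n ω ∂P = 0 := by
  simp only [V]
  rw [integral_const_mul, integral_finsetSum _ fun (k : ℕ) _ => (hX.allMoments_H q k).integrable]
  simp [hX.integral_H hq]

lemma integral_sum_H_sq (hX : IsStationaryGaussian P X ρ) (m n : ℕ) (x : ℕ → ℝ) :
    ∫ ω, (∑ k ∈ Finset.range n, x k * H m (X k ω)) ^ 2 ∂P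
      = m ! * ∑ b ∈ Finset.range n, ∑ a ∈ Finset.range n,
          ρ ((a : ℤ) - b) ^ m * (x a * x b) := by
  have hi : ∀ b a : ℕ, Integrable (fun ω => x b * x a * (H m (X b ω) * H m (X a ω))) P :=
    fun b a => (((hX.allMoments_H m b).mul (hX.allMoments_H m a)).const_mul _).integrable
  calc _ = ∫ ω, ∑ b ∈ Finset.range n, ∑ a ∈ Finset.range n,
        x b * x a * (H m (X b ω) * H m (X a ω)) ∂P := by
        refine integral_congr_ae (ae_of_all _ fun ω => ?_)
        simp only [sq, Finset.sum_mul_sum]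
        exact Finset.sum_congr rfl fun b _ => Finset.sum_congr rfl fun a _ => by ring
    _ = _ := by
        rw [integral_finsetSum _ fun b _ => integrable_finsetSum _ fun a _ => hi b a,
          Finset.mul_sum]
        refine Finset.sum_congr rfl fun b _ => ?_
        rw [integral_finsetSum _ fun a _ => hi b a, Finset.mul_sum]
        refine Finset.sum_congr rfl fun a _ => ?_
        rw [integral_const_mul, hX.integral_H_mul_H]
        ring

/-- m! ρ(a-b)^m is the Gram matrix of the variables H_m(X_k), so no Schur product argument is
required. -/
lemma isPosDefSeq_pow (hX : IsStationaryGaussian P X ρ) (m : ℕ) :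
    IsPosDefSeq fun k => ρ k ^ m where
  even k := by rw [hX.even_cov]
  nonneg n x := by
    have h : 0 ≤ ∫ ω, (∑ k ∈ Finset.range n, x k * H m (X k ω)) ^ 2 ∂P :=
      integral_nonneg fun ω => sq_nonneg _
    rw [hX.integral_sum_H_sq] at h
    exact (mul_nonneg_iff_of_pos_left (by positivity)).1 h

lemma v_eq (hX : IsStationaryGaussian P X ρ) (q n : ℕ) :
    v P X q n = q ! * ((∑ b ∈ Finset.range n, ∑ a ∈ Finset.range n, ρ ((a : ℤ) - b) ^ q) / n) := by
  have h := hX.integral_sum_H_sq q n fun _ => 1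
  simp only [one_mul, mul_one] at h
  simp only [v, V, mul_pow, integral_const_mul]
  rw [h, div_pow, Real.sq_sqrt (Nat.cast_nonneg n)]
  ring

/-- For even q all terms ρ^q are nonnegative and the n diagonal ones equal 1. Being uniform in n,
the bound also keeps the limiting variance positive. -/
lemma factorial_le_v (hX : IsStationaryGaussian P X ρ) {q : ℕ} (hq : Even q) {n : ℕ} (hn : 1 ≤ n) :
    (q ! : ℝ) ≤ v P X q n := by
  have hn' : (0 : ℝ) < n := by exact_mod_cast hn
  rw [hX.v_eq]
  refine le_mul_of_one_le_right (by positivity) ((one_le_div hn').2 ?_)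
  calc (n : ℝ) = ∑ b ∈ Finset.range n, 1 := by simp
    _ ≤ _ := by
      refine Finset.sum_le_sum fun b hb => ?_
      have h := Finset.single_le_sum (f := fun a : ℕ => ρ ((a : ℤ) - b) ^ q)
        (fun a _ => hq.pow_nonneg _) hb
      simpa [hX.unit_variance] using h

lemma v_pos (hX : IsStationaryGaussian P X ρ) {q : ℕ} (hq : Even q) {n : ℕ} (hn : 1 ≤ n) :
    0 < v P X q n :=
  lt_of_lt_of_le (by positivity) (hX.factorial_le_v hq hn)

lemma integral_V_cube (hX : IsStationaryGaussian P X ρ) {m : ℕ} (hm : m ≠ 0) (n : ℕ) :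
    ∫ ω, V X (2 * m) n ω ^ 3 ∂P = d₃ (2 * m) / √(n : ℝ) ^ 3 *
      ∑ b ∈ Finset.range n, ∑ a ∈ Finset.range n, ∑ c ∈ Finset.range n,
        ρ ((a : ℤ) - b) ^ m * ρ ((c : ℤ) - b) ^ m * ρ ((c : ℤ) - a) ^ m := by
  have hi : ∀ b a c : ℕ, Integrable
      (fun ω => H (2 * m) (X b ω) * H (2 * m) (X a ω) * H (2 * m) (X c ω)) P := fun b a c =>
    (((hX.allMoments_H _ b).mul (hX.allMoments_H _ a)).mul (hX.allMoments_H _ c)).integrable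
  have h : ∫ ω, (∑ k ∈ Finset.range n, H (2 * m) (X k ω)) ^ 3 ∂P
      = d₃ (2 * m) * ∑ b ∈ Finset.range n, ∑ a ∈ Finset.range n, ∑ c ∈ Finset.range n,
        ρ ((a : ℤ) - b) ^ m * ρ ((c : ℤ) - b) ^ m * ρ ((c : ℤ) - a) ^ m := by
    calc _ = ∫ ω, ∑ b ∈ Finset.range n, ∑ a ∈ Finset.range n, ∑ c ∈ Finset.range n,
          H (2 * m) (X b ω) * H (2 * m) (X a ω) * H (2 * m) (X c ω) ∂P := by
          refine integral_congr_ae (ae_of_all _ fun ω => ?_)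
          beta_reduce
          rw [pow_three', Finset.sum_mul_sum]
          simp only [Finset.sum_mul, Finset.mul_sum]
          rw [Finset.sum_comm]
          exact Finset.sum_congr rfl fun b _ => Finset.sum_comm
      _ = _ := by
          rw [integral_finsetSum _ fun b _ => integrable_finsetSum _ fun a _ =>
            integrable_finsetSum _ fun c _ => hi b a c, Finset.mul_sum]
          refine Finset.sum_congr rfl fun b _ => ?_
          rw [integral_finsetSum _ fun a _ => integrable_finsetSum _ fun c _ => hi b a c,
            Finset.mul_sum]
          refine Finset.sum_congr rfl fun a _ => ?_
          rw [integral_finsetSum _ fun c _ => hi b a c, Finset.mul_sum]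
          refine Finset.sum_congr rfl fun c _ => ?_
          rw [hX.integral_H_mul_H_mul_H hm]
  simp only [V, mul_pow, integral_const_mul]
  rw [h]
  ring

lemma memLp_F (hX : IsStationaryGaussian P X ρ) (q n : ℕ) : MemLp (F P X q n) 3 P := by
  have h := ((hX.allMoments_V q n).const_mul (√(v P X q n))⁻¹) 3 (by simp)
  exact (memLp_congr_ae (ae_of_all _ fun ω => (div_eq_inv_mul _ _).symm)).1 h

lemma cumulant_F (hX : IsStationaryGaussian P X ρ) {m : ℕ} (hm : m ≠ 0) {n : ℕ} (hn : 1 ≤ n) :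
    cumulant P 3 (F P X (2 * m) n) = d₃ (2 * m) / (v P X (2 * m) n ^ (3 / 2 : ℝ) * √(n : ℝ)) *
      ((∑ b ∈ Finset.range n, ∑ a ∈ Finset.range n, ∑ c ∈ Finset.range n,
        ρ ((a : ℤ) - b) ^ m * ρ ((c : ℤ) - b) ^ m * ρ ((c : ℤ) - a) ^ m) / n) := by
  have := hX.gaussian.isProbabilityMeasure
  have hn' : (0 : ℝ) < n := by exact_mod_cast hn
  have hv := hX.v_pos (even_two_mul m) hn
  rw [cumulant_three_eq_integral (hX.memLp_F _ n)]
  · have e : √(v P X (2 * m) n) ^ 3 = v P X (2 * m) n ^ (3 / 2 : ℝ) := by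
      rw [Real.sqrt_eq_rpow, ← Real.rpow_natCast, ← Real.rpow_mul hv.le]
      norm_num
    have e2 : √(n : ℝ) ^ 3 = √(n : ℝ) * n := by
      rw [pow_succ, Real.sq_sqrt hn'.le, mul_comm]
    simp only [F, div_pow, integral_div]
    rw [hX.integral_V_cube hm, e, e2]
    field_simp
  · simp only [F, integral_div]
    rw [hX.integral_V (by omega), zero_div]

lemma abs_pow_rpow (x : ℝ) (m : ℕ) :
    |x ^ m| ^ (3 / 2 : ℝ) = |x| ^ (3 * ((2 * m : ℕ) : ℝ) / 4) := by
  rw [abs_pow, ← Real.rpow_natCast, ← Real.rpow_mul (abs_nonneg x)]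
  congr 1
  push_cast
  ring

lemma cumulant_F_le (hX : IsStationaryGaussian P X ρ) {m : ℕ} (hm : m ≠ 0) {n : ℕ} (hn : 1 ≤ n) :
    cumulant P 3 (F P X (2 * m) n) ≤ d₃ (2 * m) / (v P X (2 * m) n ^ (3 / 2 : ℝ) * √(n : ℝ)) *
      (∑ k ∈ Finset.Ioo (-(n : ℤ)) n, |ρ k| ^ (3 * ((2 * m : ℕ) : ℝ) / 4)) ^ 2 := by
  have hn' : (0 : ℝ) < n := by exact_mod_cast hn
  have hv := hX.v_pos (even_two_mul m) hn
  rw [hX.cumulant_F hm hn]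
  refine mul_le_mul_of_nonneg_left ?_ (by positivity)
  rw [div_le_iff₀ hn', mul_comm]
  have h := sum_mul_mul_le (fun k => ρ k ^ m) (hX.isPosDefSeq_pow m).even n
  simpa only [abs_pow_rpow] using h

lemma tendsto_cumulant_F (hX : IsStationaryGaussian P X ρ) {m : ℕ} (hm : m ≠ 0)
    (hs : Summable fun k => |ρ k ^ m| ^ (3 / 2 : ℝ)) :
    Tendsto (fun n : ℕ => √(n : ℝ) * cumulant P 3 (F P X (2 * m) n)) atTop
      (𝓝 (d₃ (2 * m) / ((2 * m)! * ∑' k, (ρ k ^ m) ^ 2) ^ (3 / 2 : ℝ)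
        * tripleSum fun k => ρ k ^ m)) := by
  have hs2 := summable_sq_of_summable_rpow hs
  have hv : Tendsto (fun n => v P X (2 * m) n) atTop (𝓝 ((2 * m)! * ∑' k, (ρ k ^ m) ^ 2)) := by
    simp only [hX.v_eq]
    refine ((tendsto_sum_sub_div hs2).const_mul _).congr fun n => ?_
    simp only [← pow_mul, mul_comm m 2]
  have hv0 : (0 : ℝ) < (2 * m)! * ∑' k, (ρ k ^ m) ^ 2 := by
    refine lt_of_lt_of_le (b := ((2 * m)! : ℝ)) (by positivity) (ge_of_tendsto hv ?_)
    filter_upwards [eventually_ge_atTop 1] with n hn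
    exact hX.factorial_le_v (even_two_mul m) hn
  have hT := tendsto_sum_sub_sub_div (summable_mul_mul hs)
  have h := (tendsto_const_nhds (x := (d₃ (2 * m) : ℝ))).div
    (hv.rpow_const (p := (3 / 2 : ℝ)) (Or.inl hv0.ne')) (Real.rpow_pos_of_pos hv0 _).ne'
  refine (h.mul hT).congr' ?_
  filter_upwards [eventually_ge_atTop 1] with n hn
  have hn' : (0 : ℝ) < n := by exact_mod_cast hn
  have hvn := hX.v_pos (even_two_mul m) hn
  have e : ∀ a b c : ℕ, (c : ℤ) - b - (a - b) = c - a := fun a b c => by ring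
  rw [hX.cumulant_F hm hn]
  simp only [e, Pi.div_apply]
  have : √(n : ℝ) ≠ 0 := by positivity
  field_simp

end IsStationaryGaussian

/-! ### Integrals over the torus -/

lemma integral_torus (h : Torus → ℝ) :
    ∫ t, h t = 2 * π * ∫ t, h t ∂(AddCircle.haarAddCircle : Measure Torus) := by
  have := Real.pi_pos
  rw [AddCircle.integral_haarAddCircle, smul_eq_mul]
  field_simp

lemma integrable_torus {h : Torus → ℝ}
    (hh : Integrable h (AddCircle.haarAddCircle : Measure Torus)) : Integrable h := by
  rw [AddCircle.volume_eq_smul_haarAddCircle]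
  exact hh.smul_measure ENNReal.ofReal_ne_top

lemma ae_torus {p : Torus → Prop}
    (hp : ∀ᵐ t ∂(AddCircle.haarAddCircle : Measure Torus), p t) : ∀ᵐ t : Torus, p t := by
  rw [AddCircle.volume_eq_smul_haarAddCircle]
  exact Measure.ae_smul_measure hp _

/-- The sum is the integral of a nonnegative cube. If it vanished, so would the function, while by
Parseval its squared norm is at least f(0)². -/
lemma IsPosDefSeq.tripleSum_pos {f : ℤ → ℝ} (hf : IsPosDefSeq f)
    (hs : Summable fun k => |f k| ^ (3 / 2 : ℝ)) (h0 : f 0 ≠ 0) : 0 < tripleSum f := by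
  have hs2 := summable_sq_of_summable_rpow hs
  obtain ⟨hi, he⟩ := hf.integrable_cube_and_integral_cube hs
  have hn := hf.ae_im_eq_zero_and_re_nonneg hs2
  have hn3 : 0 ≤ᵐ[(AddCircle.haarAddCircle : Measure Torus)]
      fun t => (fourierSum f t).re ^ 3 := by
    filter_upwards [hn] with t ht using pow_nonneg ht.2 3
  rw [← he]
  refine (integral_nonneg_of_ae hn3).lt_of_ne' fun hz => ?_
  have h3 := (integral_eq_zero_iff_of_nonneg_ae hn3 hi).1 hz
  have h2 : ∫ t, (fourierSum f t).re ^ 2 ∂(AddCircle.haarAddCircle : Measure Torus) = 0 := by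
    refine integral_eq_zero_of_ae ?_
    filter_upwards [h3] with t ht
    simpa using ht
  rw [hf.integral_sq hs2] at h2
  have := hs2.tsum_pos (fun k => sq_nonneg _) 0 (by positivity)
  exact this.ne' h2

end BreuerMajor

end

/-! ### The main theorem -/

theorem proposition5p2 {Ω : Type*} [MeasurableSpace Ω] (P : Measure Ω) [IsProbabilityMeasure P]
    (X : ℤ → Ω → ℝ) (ρ : ℤ → ℝ) (hX : BreuerMajor.IsStationaryGaussian P X ρ)
    (q : ℕ) (hq : 2 ≤ q) (hq_even : Even q) :
    (∀ n : ℕ, 1 ≤ n →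
      0 < BreuerMajor.v P X q n ∧
      MemLp (BreuerMajor.F P X q n) 3 P ∧
      BreuerMajor.cumulant P 3 (BreuerMajor.F P X q n) ≤
        (BreuerMajor.d₃ q : ℝ) / (BreuerMajor.v P X q n ^ (3 / 2 : ℝ) * √(n : ℝ)) *
          (∑ k ∈ Finset.Ioo (-(n : ℤ)) (n : ℤ), |ρ k| ^ (3 * (q : ℝ) / 4)) ^ 2) ∧
    (Summable (fun k : ℤ => |ρ k| ^ (3 * (q : ℝ) / 4)) →
      Summable (BreuerMajor.fourierTerm (fun k => ρ k ^ (q / 2))) ∧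
      (∀ᵐ t : BreuerMajor.Torus,
        (BreuerMajor.fourierSum (fun k => ρ k ^ (q / 2)) t).im = 0 ∧
        0 ≤ BreuerMajor.g ρ (q / 2) t) ∧
      Integrable (fun t : BreuerMajor.Torus => BreuerMajor.g ρ (q / 2) t ^ 2) ∧
      Integrable (fun t : BreuerMajor.Torus => BreuerMajor.g ρ (q / 2) t ^ 3) ∧
      0 < ∫ t : BreuerMajor.Torus, BreuerMajor.g ρ (q / 2) t ^ 2 ∧
      0 < ∫ t : BreuerMajor.Torus, BreuerMajor.g ρ (q / 2) t ^ 3 ∧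
      Tendsto (fun n : ℕ => √(n : ℝ) * BreuerMajor.cumulant P 3 (BreuerMajor.F P X q n)) atTop
        (𝓝 ((BreuerMajor.d₃ q : ℝ) / (q ! : ℝ) ^ (3 / 2 : ℝ) * √(2 * π) *
          ((∫ t : BreuerMajor.Torus, BreuerMajor.g ρ (q / 2) t ^ 3) /
            (∫ t : BreuerMajor.Torus, BreuerMajor.g ρ (q / 2) t ^ 2) ^ (3 / 2 : ℝ))))) := by
  obtain ⟨m, rfl⟩ := hq_even.two_dvd
  have hm : m ≠ 0 := by omega
  refine ⟨fun n hn => ⟨hX.v_pos hq_even hn, hX.memLp_F _ n, hX.cumulant_F_le hm hn⟩, fun hs => ?_⟩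
  rw [Nat.mul_div_cancel_left m two_pos]
  simp only [← BreuerMajor.IsStationaryGaussian.abs_pow_rpow] at hs
  have hs2 := BreuerMajor.summable_sq_of_summable_rpow hs
  have hf := hX.isPosDefSeq_pow m
  obtain ⟨hi3, he3⟩ := hf.integrable_cube_and_integral_cube hs
  have hS := hf.tripleSum_pos hs (by simp [hX.unit_variance])
  have hQ : 0 < ∑' k, (ρ k ^ m) ^ 2 :=
    hs2.tsum_pos (fun k => sq_nonneg _) 0 (by simp [hX.unit_variance])
  have h2 : ∫ t : BreuerMajor.Torus, BreuerMajor.g ρ m t ^ 2 = 2 * π * ∑' k, (ρ k ^ m) ^ 2 := by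
    rw [BreuerMajor.integral_torus, ← hf.integral_sq hs2]
    rfl
  have h3 : ∫ t : BreuerMajor.Torus, BreuerMajor.g ρ m t ^ 3
      = 2 * π * BreuerMajor.tripleSum fun k => ρ k ^ m := by
    rw [BreuerMajor.integral_torus, ← he3]
    rfl
  refine ⟨BreuerMajor.summable_fourierTerm hs2,
    BreuerMajor.ae_torus (hf.ae_im_eq_zero_and_re_nonneg hs2),
    BreuerMajor.integrable_torus (hf.integrable_sq hs2), BreuerMajor.integrable_torus hi3,
    by rw [h2]; positivity, by rw [h3]; positivity, ?_⟩
  convert hX.tendsto_cumulant_F hm hs using 2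
  -- The volume integrals carry 2π in the numerator and (2π)^{3/2} in the denominator; the factor
  -- √(2π) of the statement compensates exactly.
  have hpi : 0 < 2 * π := Real.two_pi_pos
  rw [h2, h3, Real.mul_rpow hpi.le hQ.le, Real.mul_rpow (by positivity) hQ.le,
    show (3 / 2 : ℝ) = 1 + 1 / 2 by norm_num, Real.rpow_add hpi, Real.rpow_one,
    ← Real.sqrt_eq_rpow (2 * π)]
  have := Real.sqrt_pos.2 hpi
  field_simp
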